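/- Let $A$ be a finite dimensional algebra over a field and let $\mathrm{mod}\,A$ be the category of finitely generated right $A$-modules. Let $K_0(A)$ be the abelian group generated by the symbols $[M]$, $M\in\mathrm{mod}\,A$, modulo the relations $[M]=[M']+[M'']$ whenever $M\cong M'\oplus M''$, and $[P]=0$ for $P$ projective. Let $\bar\Omega\colon K_0(A)\to K_0(A)$ be the endomorphism given by $\bar\Omega[M]=[\Omega M]$, where $\Omega M$ is the kernel of a projective cover of $M$. For $M\in\mathrm{mod}\,A$ let $\langle\mathrm{add}\,M\rangle\subseteq K_0(A)$ be the subgroup generated by the classes of the indecomposable direct summands of $M$. The Igusa–Todorov function is $$\phi(M)=\min\{\,l\in\mathbb{N} : \bar\Omega|_{\bar\Omega^{\,l+s}\langle\mathrm{add}\,M\rangle}\text{ is injective for all } s\in\mathbb{N}\,\},$$ and $\phi\dim(A)=\sup\{\phi(M): M\in\mathrm{mod}\,A\}\in\mathbb{N}\cup\{\infty\}$. **Theorem.** Suppose $\phi\dim(A)>0$. 1. There is $M\in\mathrm{mod}\,A$ with $\phi(M)=1$. 2. If $\phi\dim(A)=m$ is finite, there is $N\in\mathrm{mod}\,A$ with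 $\phi(N)=m-1$. 3. If $A$ has infinite global dimension, there are indecomposable $M_1,M_2\in\mathrm{mod}\,A$ with $\phi(M_1\oplus M_2)=1$. -/

import Mathlib

open CategoryTheory

namespace IgusaTodorov

universe u v

/-! Modules are left modules over a ring `R`; right modules over an algebra `A` are obtained for
`R = Aᵐᵒᵖ`. -/

section Definitions

variable (R : Type u) [Ring R]

/-- The category of finitely generated modules over `R`, in the universe of `R`. -/
abbrev FGMod : Type (u + 1) := FGModuleCat.{u} R

/-- The defining relators of `K₀`: `[M] - [M'] - [M'']` whenever `M ≅ M' ⊕ M''`, and `[P]` for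
every finitely generated projective module `P`. -/
def k0Relators : Set (FreeAbelianGroup (FGMod R)) :=
  {x | ∃ M M' M'' : FGMod R, Nonempty (M ≃ₗ[R] M' × M'') ∧
      x = FreeAbelianGroup.of M - FreeAbelianGroup.of M' - FreeAbelianGroup.of M''} ∪
  {x | ∃ P : FGMod R, Module.Projective R P ∧ x = FreeAbelianGroup.of P}

/-- The abelian group `K₀` generated by the symbols `[M]`, `M` a finitely generated module,
modulo `k0Relators`. -/
abbrev K0 : Type (u + 1) :=
  FreeAbelianGroup (FGMod R) ⧸ AddSubgroup.closure (k0Relators R)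

variable {R}

/-- The direct sum `M ⊕ N`. -/
abbrev directSum (M N : FGMod R) : FGMod R := FGModuleCat.of R (M × N)

/-- The class `[M]` in `K₀`. -/
def k0Class (M : FGMod R) : K0 R :=
  QuotientAddGroup.mk (FreeAbelianGroup.of M)

/-- `f : P → M` is a projective cover: `P` is projective, `f` is onto and its kernel is
superfluous. -/
structure IsProjectiveCover {P M : Type*} [AddCommGroup P] [Module R P] [AddCommGroup M]
    [Module R M] (f : P →ₗ[R] M) : Prop where
  projective : Module.Projective R P
  surjective : Function.Surjective f
  superfluous : ∀ N : Submodule R P, N ⊔ LinearMap.ker f = ⊤ → N = ⊤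

/-- Over a (one-sided) Artinian ring every finitely generated module has a projective cover. -/
theorem exists_isProjectiveCover [IsArtinianRing R] (M : FGMod R) :
    ∃ (P : FGMod R) (f : P →ₗ[R] M), IsProjectiveCover f := by
  classical
  -- take a projective presentation of minimal length
  let S : Set ℕ := {n | ∃ (P : FGMod R) (f : P →ₗ[R] M),
    Module.Projective R P ∧ Function.Surjective f ∧ Module.length R P = n}
  have hlen : ∀ P : FGMod R, ∃ n : ℕ, Module.length R P = n := fun P => by
    have : Module.length R P ≠ ⊤ := Module.length_ne_top
    exact ⟨(Module.length R P).toNat, (ENat.natCast_toNat this).symm⟩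
  have hS : S.Nonempty := by
    obtain ⟨n, f, hf⟩ := Module.Finite.exists_fin' R M
    obtain ⟨m, hm⟩ := hlen (FGModuleCat.of R (Fin n → R))
    exact ⟨m, FGModuleCat.of R (Fin n → R), f,
      inferInstanceAs (Module.Projective R (Fin n → R)), hf, hm⟩
  obtain ⟨P, f, hP, hf, hn⟩ := Nat.sInf_mem hS
  refine ⟨P, f, hP, hf, fun N hN => ?_⟩
  have hNs : Function.Surjective (f ∘ₗ N.subtype) := by
    intro m
    obtain ⟨p, rfl⟩ := hf m
    have hp : p ∈ N ⊔ LinearMap.ker f := hN ▸ Submodule.mem_top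
    obtain ⟨y, hy, z, hz, rfl⟩ := Submodule.mem_sup.1 hp
    exact ⟨⟨y, hy⟩, by simp [LinearMap.mem_ker.1 hz]⟩
  obtain ⟨g₀, hg₀⟩ := Module.projective_lifting_property (f ∘ₗ N.subtype) f hNs
  let g : Module.End R P := N.subtype ∘ₗ g₀
  have hfg : f ∘ₗ g = f := hg₀
  have hfgn : ∀ n, f ∘ₗ (g ^ n : Module.End R P) = f := fun n => by
    induction n with
    | zero => rfl
    | succ k ih => rw [pow_succ, Module.End.mul_eq_comp, ← LinearMap.comp_assoc, ih, hfg]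
  obtain ⟨n, hc⟩ := (LinearMap.eventually_isCompl_ker_pow_range_pow g).exists_forall_of_atTop
  have hc := hc (n + 1) (Nat.le_succ n)
  set I := LinearMap.range (g ^ (n + 1)) with hI
  have hIproj : Module.Projective R I :=
    Module.Projective.of_split I.subtype (I.projectionOnto _ hc.symm)
      (by ext x; simp)
  have hIs : Function.Surjective (f ∘ₗ I.subtype) := by
    intro m
    obtain ⟨p, rfl⟩ := hf m
    exact ⟨⟨(g ^ (n + 1)) p, p, rfl⟩, LinearMap.congr_fun (hfgn (n + 1)) p⟩
  have hItop : I = ⊤ := by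
    by_contra hne
    have hlt : Module.length R I < Module.length R P := Submodule.length_lt hne
    obtain ⟨m, hm⟩ := hlen (FGModuleCat.of R I)
    have hmS : m ∈ S := ⟨FGModuleCat.of R I, f ∘ₗ I.subtype, hIproj, hIs, hm⟩
    have h1 := Nat.sInf_le hmS
    have hm' : Module.length R I = m := hm
    rw [hm', hn] at hlt
    exact absurd h1 (not_le.2 (by exact_mod_cast hlt))
  rw [eq_top_iff, ← hItop]
  rintro _ ⟨p, rfl⟩
  rw [pow_succ']
  exact (g₀ ((g ^ n) p)).2

/-- The syzygy `Ω M`: the kernel of a projective cover of `M`. -/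
noncomputable def syzygy [IsArtinianRing R] (M : FGMod R) : FGMod R :=
  FGModuleCat.of R (LinearMap.ker (exists_isProjectiveCover M).choose_spec.choose)

theorem k0Class_of_equiv_prod {M M' M'' : FGMod R} (e : M ≃ₗ[R] M' × M'') :
    k0Class M = k0Class M' + k0Class M'' := by
  have h : (QuotientAddGroup.mk (FreeAbelianGroup.of M - FreeAbelianGroup.of M' -
      FreeAbelianGroup.of M'') : K0 R) = 0 :=
    (QuotientAddGroup.eq_zero_iff _).2
      (AddSubgroup.subset_closure (Or.inl ⟨M, M', M'', ⟨e⟩, rfl⟩))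
  have h' : k0Class M - k0Class M' - k0Class M'' = 0 := h
  rw [sub_sub, sub_eq_zero] at h'
  exact h'

theorem k0Class_of_projective (P : FGMod R) (hP : Module.Projective R P) :
    k0Class P = 0 :=
  (QuotientAddGroup.eq_zero_iff _).2 (AddSubgroup.subset_closure (Or.inr ⟨P, hP, rfl⟩))

/-- Schanuel's lemma. -/
theorem schanuel {P Q M : Type*} [AddCommGroup P] [Module R P] [AddCommGroup Q] [Module R Q]
    [AddCommGroup M] [Module R M] [Module.Projective R P] [Module.Projective R Q]
    (f : P →ₗ[R] M) (g : Q →ₗ[R] M) (hf : Function.Surjective f) (hg : Function.Surjective g) :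
    Nonempty ((LinearMap.ker f × Q) ≃ₗ[R] (LinearMap.ker g × P)) := by
  obtain ⟨s, hs⟩ := Module.projective_lifting_property g f hg
  obtain ⟨t, ht⟩ := Module.projective_lifting_property f g hf
  have hs' : ∀ p, g (s p) = f p := fun p => LinearMap.congr_fun hs p
  have ht' : ∀ q, f (t q) = g q := fun q => LinearMap.congr_fun ht q
  have h1 : ∀ x : LinearMap.ker f, f x = 0 := fun x => x.2
  have h2 : ∀ y : LinearMap.ker g, g y = 0 := fun y => y.2
  refine ⟨{ toFun := fun x => (⟨x.2 - s (x.1 + t x.2), ?_⟩, x.1 + t x.2)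
            invFun := fun y => (⟨y.2 - t (y.1 + s y.2), ?_⟩, y.1 + s y.2)
            map_add' := ?_
            map_smul' := ?_
            left_inv := ?_
            right_inv := ?_ }⟩
  · simp [hs', ht', h1]
  · rintro ⟨a, q⟩ ⟨b, r⟩
    ext <;> simp <;> abel
  · rintro c ⟨a, q⟩
    ext <;> simp [smul_sub]
  · simp [hs', ht', h2]
  · rintro ⟨a, q⟩
    ext <;> simp
  · rintro ⟨a, q⟩
    ext <;> simp

/-- The class of the kernel of a projective presentation depends only on the module. -/
theorem k0Class_ker_eq [IsNoetherianRing R] {P Q M : FGMod R}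
    (hP : Module.Projective R P) (hQ : Module.Projective R Q)
    (f : P →ₗ[R] M) (g : Q →ₗ[R] M) (hf : Function.Surjective f) (hg : Function.Surjective g) :
    k0Class (FGModuleCat.of R (LinearMap.ker f)) =
      k0Class (FGModuleCat.of R (LinearMap.ker g)) := by
  obtain ⟨e⟩ := schanuel f g hf hg
  let X : FGMod R := FGModuleCat.of R (LinearMap.ker f × Q)
  have h1 : k0Class X = k0Class (FGModuleCat.of R (LinearMap.ker f)) + k0Class Q :=
    k0Class_of_equiv_prod (LinearEquiv.refl R (LinearMap.ker f × Q))
  have h2 : k0Class X = k0Class (FGModuleCat.of R (LinearMap.ker g)) + k0Class P :=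
    k0Class_of_equiv_prod e
  rw [k0Class_of_projective P hP, add_zero] at h2
  rw [k0Class_of_projective Q hQ, add_zero] at h1
  exact h1.symm.trans h2

/-- `[Ω M]` can be computed from any projective presentation of `M`. -/
theorem k0Class_syzygy [IsArtinianRing R] {P M : FGMod R}
    (hP : Module.Projective R P) (f : P →ₗ[R] M) (hf : Function.Surjective f) :
    k0Class (syzygy M) = k0Class (FGModuleCat.of R (LinearMap.ker f)) :=
  have h := (exists_isProjectiveCover M).choose_spec.choose_spec
  k0Class_ker_eq h.projective hP _ f h.surjective hf

variable (R) in
/-- The relators are respected by `[M] ↦ [Ω M]`. -/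
theorem lift_syzygy_eq_zero [IsArtinianRing R] :
    AddSubgroup.closure (k0Relators R) ≤
      (FreeAbelianGroup.lift fun M : FGMod R => k0Class (syzygy M)).ker := by
  rw [AddSubgroup.closure_le]
  rintro _ (⟨M, M', M'', ⟨e⟩, rfl⟩ | ⟨P, hP, rfl⟩)
  · obtain ⟨P', f', h'⟩ := exists_isProjectiveCover M'
    obtain ⟨P'', f'', h''⟩ := exists_isProjectiveCover M''
    have := h'.projective
    have := h''.projective
    let f : FGModuleCat.of R (P' × P'') →ₗ[R] M := e.symm.toLinearMap ∘ₗ f'.prodMap f''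
    have hf : Function.Surjective f :=
      e.symm.surjective.comp (h'.surjective.prodMap h''.surjective)
    have hk : LinearMap.ker f = (LinearMap.ker f').prod (LinearMap.ker f'') := by
      rw [← LinearMap.ker_prodMap]
      exact LinearEquiv.ker_comp e.symm _
    have h1 := k0Class_syzygy (inferInstanceAs (Module.Projective R (P' × P''))) f hf
    have h2 : k0Class (FGModuleCat.of R (LinearMap.ker f)) =
        k0Class (FGModuleCat.of R (LinearMap.ker f')) +
          k0Class (FGModuleCat.of R (LinearMap.ker f'')) :=
      k0Class_of_equiv_prod
        ((LinearEquiv.ofEq _ _ hk).trans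
          { toFun := fun x => (⟨x.1.1, x.2.1⟩, ⟨x.1.2, x.2.2⟩)
            invFun := fun y => ⟨(y.1.1, y.2.1), y.1.2, y.2.2⟩
            map_add' := fun _ _ => rfl
            map_smul' := fun _ _ => rfl
            left_inv := fun _ => rfl
            right_inv := fun _ => rfl })
    have h3 := k0Class_syzygy h'.projective f' h'.surjective
    have h4 := k0Class_syzygy h''.projective f'' h''.surjective
    simp [AddMonoidHom.mem_ker, h1, h2, h3, h4]
  · have h1 := k0Class_syzygy hP (LinearMap.id : P →ₗ[R] P) Function.surjective_id
    have h2 : Module.Projective R (LinearMap.ker (LinearMap.id : P →ₗ[R] P)) := by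
      rw [LinearMap.ker_id]; infer_instance
    have h3 := k0Class_of_projective
      (FGModuleCat.of R (LinearMap.ker (LinearMap.id : P →ₗ[R] P))) h2
    simp only [SetLike.mem_coe, AddMonoidHom.mem_ker, FreeAbelianGroup.lift_apply_of]
    exact h1.trans h3

variable (R) in
/-- The endomorphism `Ω̄` of `K₀` induced by `Ω`, that is `Ω̄ [M] = [Ω M]`. -/
noncomputable def omegaBar [IsArtinianRing R] : AddMonoid.End (K0 R) :=
  QuotientAddGroup.lift (AddSubgroup.closure (k0Relators R))
    (FreeAbelianGroup.lift fun M : FGMod R => k0Class (syzygy M))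
    (lift_syzygy_eq_zero R)

theorem omegaBar_k0Class [IsArtinianRing R] (M : FGMod R) :
    omegaBar R (k0Class M) = k0Class (syzygy M) := by
  change FreeAbelianGroup.lift _ (FreeAbelianGroup.of M) = _
  rw [FreeAbelianGroup.lift_apply_of]

/-- `⟨add M⟩`: the subgroup of `K₀` generated by the classes of the indecomposable direct summands
of `M`. -/
def addSubgroupOf (M : FGMod R) : AddSubgroup (K0 R) :=
  AddSubgroup.closure {x | ∃ X Y : FGMod R, Indecomposable X.obj ∧
    Nonempty (M ≃ₗ[R] X × Y) ∧ x = k0Class X}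

/-- The Igusa-Todorov function: `φ(M)` is the least `l` such that for all `s` the restriction of
`Ω̄` to `Ω̄ ^ (l + s) ⟨add M⟩` is injective. -/
noncomputable def phi [IsArtinianRing R] (M : FGMod R) : ℕ :=
  sInf {l | ∀ s : ℕ, Set.InjOn (omegaBar R)
    ((addSubgroupOf M).map (omegaBar R ^ (l + s)) : AddSubgroup (K0 R))}

variable (R)

/-- The `φ`-dimension: the supremum of `φ(M)` over all finitely generated modules `M`. -/
noncomputable def phiDim [IsArtinianRing R] : ℕ∞ :=
  ⨆ M : FGMod R, (phi M : ℕ∞)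

/-- The global dimension: the supremum of the projective dimensions of the finitely generated
modules (with the convention that the zero module has projective dimension `⊥`). -/
noncomputable def gldim : WithBot ℕ∞ :=
  ⨆ M : FGMod R, projectiveDimension M.obj

end Definitions

/-- The opposite of a finite dimensional algebra is a left Artinian ring. -/
theorem isArtinianRing_op (k : Type v) (A : Type u) [Field k] [Ring A] [Algebra k A]
    [FiniteDimensional k A] : IsArtinianRing Aᵐᵒᵖ :=
  IsArtinianRing.of_finite k Aᵐᵒᵖ

end IgusaTodorov

/-!
Everything holds over an Artinian ring `R`. Write `T` for the endomorphism `Ω̄` of `K₀`. The group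
`⟨add M⟩` is finitely generated, so the kernels of the powers of `T` on it stabilise, and `φ(M)` is
the largest order of nilpotency of an element of `⟨add M⟩` (`phi_le_iff`).

*The value `m - 1`* (`exists_phi_eq_sub_one`). Let `φ(M) = m` be maximal and let `N` be the sum of
the syzygies of the indecomposable summands of `M`. Then `T ⟨add M⟩ ⊆ ⟨add N⟩`, so `φ(N) ≥ m - 1`.
Conversely each summand `X` of `N` embeds in a projective module `P` and `[X] = T [P / X]`, so
`⟨add N⟩ ⊆ T ⟨add Z⟩` for some `Z`; an element of order greater than `m - 1` in `⟨add N⟩` would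
give one of order greater than `m` in `⟨add Z⟩`.

*The value `1`* (`exists_phi_directSum_eq_one`). If a nonprojective module has a projective syzygy,
then some indecomposable `Y` has `[Y] ≠ 0` and `T [Y] = 0`, and `φ(Y ⊕ Y) = 1`. Otherwise `T` kills
the class of no nonprojective module, and any two nonisomorphic indecomposable nonprojective
modules with `T [M₁] = n T [M₂]` satisfy `φ(M₁ ⊕ M₂) = 1`. Suppose that no such pair exists
(`SyzygyRigid`). Then `R` is self-injective, and so `T` is injective and `φ` vanishes:

* Quotients of an indecomposable projective module `P` are indecomposable and `T [P / N] = [N]`, so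
  isomorphic proper nonzero submodules of indecomposable projective modules are conjugate
  (`SyzygyRigid.exists_equiv_map_eq`). In particular a simple module embeds in at most one
  indecomposable projective module. As there are as many of these as there are simple modules, and
  finitely many, the socle of `P` is isotypic (`SyzygyRigid.simple_equiv`).
* Hence the automorphisms of `P` act transitively on its simple submodules, which forces the
  indecomposable summands of the radical `m` of `P` to be isomorphic to a single `Y`. From
  `T [P / m] = [m] = n [Y] = n T [P / Y]` it follows that `m` is zero or indecomposable
  (`SyzygyRigid.eq_bot_or_isIndec_radical`).
* A homomorphism from `m` to an indecomposable projective module `P'` that does not extend to `P`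
  would yield a nonsplit extension of `P / m` by `P'`, indecomposable by the previous point and with
  the same syzygy class as `P / m`. So all such homomorphisms extend
  (`SyzygyRigid.exists_extension_radical`), and projective modules are relatively injective.
* If `T [U] = T [V]`, the syzygies of `U` and `V` are stably isomorphic, and so are `U` and `V` by
  the dual of Schanuel's lemma.

That the syzygies are stably isomorphic rests on the Krull-Schmidt theorem, here in the form of
additive multiplicity functions `multHom : K₀ → ℤ`, one for each indecomposable nonprojective
module.
-/

namespace IgusaTodorov

universe u

/-! ### Indecomposable modules -/

/-- A module is indecomposable if it is nonzero and has no nontrivial pair of complementary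
submodules. -/
structure IsIndec (R : Type*) [Ring R] (M : Type*) [AddCommGroup M] [Module R M] : Prop where
  nontrivial : Nontrivial M
  eq_bot_or_eq_bot : ∀ p q : Submodule R M, IsCompl p q → p = ⊥ ∨ q = ⊥

/-- `X` is isomorphic to a direct summand of `M`, expressed by a split monomorphism. -/
def IsSummand (R : Type*) [Ring R] (X M : Type*) [AddCommGroup X] [Module R X] [AddCommGroup M]
    [Module R M] : Prop :=
  ∃ (i : X →ₗ[R] M) (r : M →ₗ[R] X), r ∘ₗ i = LinearMap.id

section Indecomposable

variable {R : Type*} [Ring R] {M N X Y Z : Type*} [AddCommGroup M] [Module R M]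
  [AddCommGroup N] [Module R N] [AddCommGroup X] [Module R X] [AddCommGroup Y] [Module R Y]
  [AddCommGroup Z] [Module R Z]

theorem IsSummand.of_bijective {i : X →ₗ[R] M} {r : M →ₗ[R] X}
    (h : Function.Bijective (r ∘ₗ i)) : IsSummand R X M := by
  let e := LinearEquiv.ofBijective (r ∘ₗ i) h
  refine ⟨i, e.symm.toLinearMap ∘ₗ r, ?_⟩
  ext x
  exact e.symm_apply_apply x

theorem IsSummand.refl : IsSummand R X X := ⟨LinearMap.id, LinearMap.id, rfl⟩

theorem IsSummand.of_equiv (e : X ≃ₗ[R] Y) : IsSummand R X Y :=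
  ⟨e.toLinearMap, e.symm.toLinearMap, by ext; simp⟩

theorem IsSummand.trans (h₁ : IsSummand R X Y) (h₂ : IsSummand R Y Z) : IsSummand R X Z := by
  obtain ⟨i, r, h⟩ := h₁
  obtain ⟨j, s, h'⟩ := h₂
  refine ⟨j ∘ₗ i, r ∘ₗ s, ?_⟩
  ext x
  have h2 := LinearMap.congr_fun h' (i x)
  have h1 := LinearMap.congr_fun h x
  simp only [LinearMap.comp_apply, LinearMap.id_apply] at h1 h2 ⊢
  rw [h2, h1]

theorem IsSummand.fst : IsSummand R X (X × Y) :=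
  ⟨LinearMap.inl R X Y, LinearMap.fst R X Y, by ext; simp⟩

theorem IsSummand.snd : IsSummand R Y (X × Y) :=
  ⟨LinearMap.inr R X Y, LinearMap.snd R X Y, by ext; simp⟩

theorem IsSummand.projective (h : IsSummand R X M) [Module.Projective R M] :
    Module.Projective R X := by
  obtain ⟨i, r, h⟩ := h
  exact Module.Projective.of_split i r h

theorem exists_equiv_prod_ker {i : X →ₗ[R] M} {r : M →ₗ[R] X} (h : r ∘ₗ i = LinearMap.id) :
    Nonempty (M ≃ₗ[R] X × LinearMap.ker r) := by
  have h' : ∀ x, r (i x) = x := fun x => LinearMap.congr_fun h x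
  exact ⟨{ toFun := fun m => (r m, ⟨m - i (r m), by simp [h']⟩)
           invFun := fun p => i p.1 + p.2
           map_add' := fun a b => by ext <;> simp; abel
           map_smul' := fun c a => by ext <;> simp [smul_sub]
           left_inv := fun m => by simp
           right_inv := fun p => by ext <;> simp [h'] }⟩

theorem IsIndec.of_equiv (h : IsIndec R M) (e : M ≃ₗ[R] N) : IsIndec R N := by
  refine ⟨?_, fun p q hpq => ?_⟩
  · have := h.nontrivial
    exact e.symm.toEquiv.nontrivial
  · have := h.eq_bot_or_eq_bot _ _ (hpq.map (Submodule.orderIsoMapComap e).symm)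
    simpa [Submodule.orderIsoMapComap] using this

theorem IsIndec.subsingleton_or_subsingleton (h : IsIndec R M) (e : M ≃ₗ[R] X × Y) :
    Subsingleton X ∨ Subsingleton Y := by
  have h' := h.of_equiv e
  have hc : IsCompl (LinearMap.range (LinearMap.inl R X Y))
      (LinearMap.range (LinearMap.inr R X Y)) :=
    LinearMap.isCompl_range_inl_inr
  rcases h'.eq_bot_or_eq_bot _ _ hc with h1 | h1
  · left
    refine ⟨fun a b => LinearMap.inl_injective (R := R) (M := X) (M₂ := Y) ?_⟩
    rw [LinearMap.range_eq_bot] at h1; rw [h1]; rfl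
  · right
    refine ⟨fun a b => LinearMap.inr_injective (R := R) (M := X) (M₂ := Y) ?_⟩
    rw [LinearMap.range_eq_bot] at h1; rw [h1]; rfl

/-- A nonzero summand of an indecomposable module is everything. -/
theorem IsSummand.nonempty_equiv (h : IsSummand R X M) (hM : IsIndec R M) [Nontrivial X] :
    Nonempty (M ≃ₗ[R] X) := by
  obtain ⟨i, r, h⟩ := h
  obtain ⟨e⟩ := exists_equiv_prod_ker h
  rcases hM.subsingleton_or_subsingleton e with h1 | h1
  · exact (not_subsingleton X h1).elim
  · refine ⟨LinearEquiv.ofBijective r ⟨?_, fun x => ⟨i x, LinearMap.congr_fun h x⟩⟩⟩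
    rw [← LinearMap.ker_eq_bot]
    exact (Submodule.subsingleton_iff_eq_bot).1 h1

section FiniteLength

variable [IsNoetherian R X] [IsArtinian R X]

/-- Fitting's lemma for an indecomposable module. -/
theorem IsIndec.bijective_or_isNilpotent (h : IsIndec R X) (f : Module.End R X) :
    Function.Bijective f ∨ IsNilpotent f := by
  obtain ⟨n, hc⟩ := (LinearMap.eventually_isCompl_ker_pow_range_pow f).exists_forall_of_atTop
  have hc := hc (n + 1) (Nat.le_succ n)
  rcases h.eq_bot_or_eq_bot _ _ hc with h1 | h1
  · left
    refine IsArtinian.bijective_of_injective_endomorphism f ?_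
    rw [LinearMap.ker_eq_bot, pow_succ] at h1
    exact Function.Injective.of_comp h1
  · right
    exact ⟨n + 1, LinearMap.range_eq_bot.1 h1⟩

theorem IsIndec.bijective_of_fixed (h : IsIndec R X) (f : Module.End R X) {x : X} (hx : x ≠ 0)
    (hf : f x = x) : Function.Bijective f := by
  rcases h.bijective_or_isNilpotent f with h1 | ⟨n, hn⟩
  · exact h1
  · refine (hx ?_).elim
    have : (f ^ n) x = x := by
      rw [Module.End.pow_apply]; exact Function.iterate_fixed hf n
    rw [← this, hn]; rfl

/-- The endomorphism ring of an indecomposable module of finite length is local. -/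
theorem IsIndec.bijective_or_bijective_of_add (h : IsIndec R X) {f g : Module.End R X}
    (hfg : Function.Bijective (f + g)) : Function.Bijective f ∨ Function.Bijective g := by
  obtain ⟨u, hu⟩ : IsUnit (f + g) := (Module.End.isUnit_iff _).2 hfg
  have h1 : (↑u⁻¹ * f : Module.End R X) + ↑u⁻¹ * g = 1 := by
    rw [← mul_add, ← hu]; simp
  rcases h.bijective_or_isNilpotent (↑u⁻¹ * f) with h2 | h2
  · left
    rw [← Module.End.isUnit_iff] at h2 ⊢
    exact (Units.isUnit_units_mul _ _).1 h2
  · right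
    have h3 : IsUnit (↑u⁻¹ * g : Module.End R X) := by
      rw [← eq_sub_iff_add_eq'] at h1
      rw [h1]; exact h2.isUnit_one_sub
    rw [← Module.End.isUnit_iff]
    exact (Units.isUnit_units_mul _ _).1 h3

/-- An indecomposable summand of `M ⊕ N` is a summand of `M` or of `N`. -/
theorem IsIndec.isSummand_or_isSummand (h : IsIndec R X) (hs : IsSummand R X (M × N)) :
    IsSummand R X M ∨ IsSummand R X N := by
  obtain ⟨i, r, hri⟩ := hs
  let f : Module.End R X := (r ∘ₗ LinearMap.inl R M N) ∘ₗ (LinearMap.fst R M N ∘ₗ i)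
  let g : Module.End R X := (r ∘ₗ LinearMap.inr R M N) ∘ₗ (LinearMap.snd R M N ∘ₗ i)
  have hfg : f + g = LinearMap.id := by
    rw [← hri]
    ext x
    simp only [f, g, LinearMap.add_apply, LinearMap.comp_apply, ← map_add]
    simp
  rcases h.bijective_or_bijective_of_add (f := f) (g := g)
    (hfg ▸ Function.bijective_id) with h1 | h1
  · exact Or.inl (.of_bijective h1)
  · exact Or.inr (.of_bijective h1)

end FiniteLength

end Indecomposable

/-! ### Decompositions of finitely generated modules and the subgroups `⟨add M⟩` -/

section FinitelyGenerated

variable {R : Type u} [Ring R]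

theorem indecomposable_iff (X : FGMod R) : Indecomposable X.obj ↔ IsIndec R X := by
  constructor
  · rintro ⟨h0, h⟩
    refine ⟨?_, fun p q hpq => ?_⟩
    · by_contra hn
      rw [not_nontrivial_iff_subsingleton] at hn
      exact h0 (ModuleCat.isZero_of_subsingleton X.obj)
    · have e : X ≃ₗ[R] p × q := (Submodule.prodEquivOfIsCompl p q hpq).symm
      have i : X.obj ≅ ModuleCat.of R p ⊞ ModuleCat.of R q :=
        e.toModuleIso ≪≫ (ModuleCat.biprodIsoProd (ModuleCat.of R p) (ModuleCat.of R q)).symm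
      rcases h _ _ i with h1 | h1
      · left
        exact Submodule.subsingleton_iff_eq_bot.1 (ModuleCat.subsingleton_of_isZero h1)
      · right
        exact Submodule.subsingleton_iff_eq_bot.1 (ModuleCat.subsingleton_of_isZero h1)
  · intro h
    refine ⟨fun h0 => ?_, fun Y Z i => ?_⟩
    · have := ModuleCat.subsingleton_of_isZero h0
      exact not_subsingleton_iff_nontrivial.2 h.nontrivial this
    · have e : X ≃ₗ[R] Y × Z := (i ≪≫ ModuleCat.biprodIsoProd Y Z).toLinearEquiv
      rcases h.subsingleton_or_subsingleton e with h1 | h1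
      · exact Or.inl (ModuleCat.isZero_of_subsingleton Y)
      · exact Or.inr (ModuleCat.isZero_of_subsingleton Z)

/-- Every property of finitely generated modules over an Artinian ring that is invariant under
isomorphism, stable under direct sums, and true for zero and indecomposable modules always holds:
every such module is a finite direct sum of indecomposable modules. -/
theorem indec_induction [IsArtinianRing R] {motive : FGMod R → Prop}
    (equiv : ∀ M N : FGMod R, (M ≃ₗ[R] N) → motive M → motive N)
    (zero : ∀ M : FGMod R, Subsingleton M → motive M)
    (indec : ∀ M : FGMod R, IsIndec R M → motive M)
    (prod : ∀ M N : FGMod R, motive M → motive N → motive (directSum M N))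
    (M : FGMod R) : motive M := by
  suffices H : ∀ (n : ℕ) (M : FGMod R), Module.length R M ≤ n → motive M by
    have : Module.length R M ≠ ⊤ := Module.length_ne_top
    exact H (Module.length R M).toNat M (ENat.natCast_toNat this).ge
  intro n
  induction n with
  | zero =>
    intro M hM
    exact zero M (Module.length_eq_zero_iff.1 (le_antisymm (by simpa using hM) bot_le))
  | succ n ih =>
    intro M hM
    by_cases hs : Subsingleton M
    · exact zero M hs
    by_cases hi : IsIndec R M
    · exact indec M hi
    have hex : ∃ p q : Submodule R M, IsCompl p q ∧ p ≠ ⊥ ∧ q ≠ ⊥ := by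
      by_contra hcon
      push Not at hcon
      refine hi ⟨not_subsingleton_iff_nontrivial.1 hs, fun p q hpq => ?_⟩
      by_cases hp : p = ⊥
      · exact Or.inl hp
      · exact Or.inr (hcon p q hpq hp)
    obtain ⟨p, q, hpq, hp, hq⟩ := hex
    have hp' : p ≠ ⊤ := by rintro rfl; exact hq (by simpa using hpq.inf_eq_bot)
    have hq' : q ≠ ⊤ := by rintro rfl; exact hp (by simpa using hpq.inf_eq_bot)
    have key : ∀ s : Submodule R M, s ≠ ⊤ → Module.length R s ≤ n := fun s hs => by
      have h1 := (Submodule.length_lt hs).trans_le hM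
      push_cast at h1
      exact ENat.lt_natCast_add_one_iff.1 h1
    exact equiv _ M (Submodule.prodEquivOfIsCompl p q hpq)
      (prod (FGModuleCat.of R p) (FGModuleCat.of R q) (ih _ (key p hp')) (ih _ (key q hq')))

variable (R) in
/-- The class `[M]` in `K₀` of an unbundled finitely generated module. -/
def cls (M : Type u) [AddCommGroup M] [Module R M] [Module.Finite R M] : K0 R :=
  k0Class (FGModuleCat.of R M)

section Classes

variable {M N X : Type u} [AddCommGroup M] [Module R M] [Module.Finite R M]
  [AddCommGroup N] [Module R N] [Module.Finite R N]
  [AddCommGroup X] [Module R X] [Module.Finite R X]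

theorem cls_of_projective [h : Module.Projective R M] : cls R M = 0 :=
  k0Class_of_projective (FGModuleCat.of R M) h

theorem cls_prod : cls R (M × N) = cls R M + cls R N :=
  k0Class_of_equiv_prod (M := FGModuleCat.of R (M × N)) (M' := FGModuleCat.of R M)
    (M'' := FGModuleCat.of R N) (LinearEquiv.refl R (M × N))

theorem cls_congr (e : M ≃ₗ[R] N) : cls R M = cls R N := by
  have h : cls R M = cls R N + cls R PUnit :=
    k0Class_of_equiv_prod (M := FGModuleCat.of R M) (M' := FGModuleCat.of R N)
      (M'' := FGModuleCat.of R PUnit) (e.trans LinearEquiv.prodUnique.symm)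
  rwa [cls_of_projective (M := PUnit), add_zero] at h

/-- Every element of `K₀` is a difference of two classes of modules. -/
theorem exists_eq_cls_sub_cls (x : K0 R) :
    ∃ M N : FGMod R, x = cls R M - cls R N := by
  induction x using QuotientAddGroup.induction_on with
  | H z =>
    induction z using FreeAbelianGroup.induction_on with
    | zero => exact ⟨FGModuleCat.of R PUnit, FGModuleCat.of R PUnit, (sub_self _).symm⟩
    | of M =>
      refine ⟨M, FGModuleCat.of R PUnit, ?_⟩
      rw [show cls R (FGModuleCat.of R PUnit) = 0 from cls_of_projective (M := PUnit), sub_zero]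
      rfl
    | neg M =>
      refine ⟨FGModuleCat.of R PUnit, M, ?_⟩
      rw [show cls R (FGModuleCat.of R PUnit) = 0 from cls_of_projective (M := PUnit), zero_sub]
      rfl
    | add a b ha hb =>
      obtain ⟨M, N, h⟩ := ha
      obtain ⟨M', N', h'⟩ := hb
      refine ⟨directSum M M', directSum N N', ?_⟩
      rw [QuotientAddGroup.mk_add, h, h', cls_prod, cls_prod]
      abel

theorem cls_mem_addSubgroupOf (hX : IsIndec R X) (h : IsSummand R X M) :
    cls R X ∈ addSubgroupOf (FGModuleCat.of R M) := by
  obtain ⟨i, r, h⟩ := h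
  -- the complement `ker r` is finitely generated, being the image of `id - i r`
  let r' : M →ₗ[R] M := LinearMap.id - i ∘ₗ r
  have hk : LinearMap.range r' = LinearMap.ker r := by
    have h' : ∀ x, r (i x) = x := fun x => LinearMap.congr_fun h x
    apply le_antisymm
    · rintro _ ⟨m, rfl⟩
      simp [r', h']
    · intro m hm
      exact ⟨m, by simp [r', LinearMap.mem_ker.1 hm]⟩
  have : Module.Finite R (LinearMap.ker r) := hk ▸ inferInstance
  obtain ⟨e⟩ := exists_equiv_prod_ker h
  exact AddSubgroup.subset_closure ⟨FGModuleCat.of R X, FGModuleCat.of R (LinearMap.ker r),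
    (indecomposable_iff _).2 hX, ⟨e⟩, rfl⟩

theorem addSubgroupOf_le {M : FGMod R} {H : AddSubgroup (K0 R)}
    (h : ∀ X : FGMod R, IsIndec R X → IsSummand R X M → cls R X ∈ H) : addSubgroupOf M ≤ H := by
  refine (AddSubgroup.closure_le _).2 ?_
  rintro _ ⟨X, Y, hX, ⟨e⟩, rfl⟩
  exact h X ((indecomposable_iff X).1 hX) (IsSummand.fst.trans (.of_equiv e.symm))

theorem addSubgroupOf_mono {M N : FGMod R} (h : IsSummand R M N) :
    addSubgroupOf M ≤ addSubgroupOf N :=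
  addSubgroupOf_le fun _ hX hXM => cls_mem_addSubgroupOf hX (hXM.trans h)

theorem addSubgroupOf_of_subsingleton {M : FGMod R} (h : Subsingleton M) :
    addSubgroupOf M = ⊥ := by
  refine le_bot_iff.1 (addSubgroupOf_le fun X hX hXM => ?_)
  obtain ⟨i, r, hir⟩ := hXM
  have := hX.nontrivial
  have : Subsingleton X := (Function.LeftInverse.injective (g := r) (f := i)
    fun x => LinearMap.congr_fun hir x).subsingleton
  exact (not_subsingleton X this).elim

theorem addSubgroupOf_of_isIndec {M : FGMod R} (h : IsIndec R M) :
    addSubgroupOf M = AddSubgroup.zmultiples (cls R M) := by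
  apply le_antisymm
  · refine addSubgroupOf_le fun X hX hXM => ?_
    have := hX.nontrivial
    obtain ⟨e⟩ := hXM.nonempty_equiv h
    rw [cls_congr e]
    exact AddSubgroup.mem_zmultiples _
  · rw [AddSubgroup.zmultiples_le]
    exact cls_mem_addSubgroupOf h .refl

variable [IsArtinianRing R]

theorem addSubgroupOf_directSum (M N : FGMod R) :
    addSubgroupOf (directSum M N) = addSubgroupOf M ⊔ addSubgroupOf N := by
  apply le_antisymm
  · refine addSubgroupOf_le fun X hX hXM => ?_
    rcases hX.isSummand_or_isSummand hXM with h | h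
    · exact AddSubgroup.mem_sup_left (cls_mem_addSubgroupOf hX h)
    · exact AddSubgroup.mem_sup_right (cls_mem_addSubgroupOf hX h)
  · exact sup_le (addSubgroupOf_mono .fst) (addSubgroupOf_mono .snd)

theorem cls_mem_addSubgroupOf_self (M : FGMod R) : cls R M ∈ addSubgroupOf M := by
  induction M using indec_induction with
  | equiv M N e h =>
    rw [← cls_congr e]
    exact addSubgroupOf_mono (.of_equiv e) h
  | zero M h =>
    rw [cls_of_projective]
    exact zero_mem _
  | indec M h => exact cls_mem_addSubgroupOf h .refl
  | prod M N hM hN =>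
    rw [addSubgroupOf_directSum, cls_prod]
    exact add_mem (AddSubgroup.mem_sup_left hM) (AddSubgroup.mem_sup_right hN)

theorem addSubgroupOf_fg (M : FGMod R) : (addSubgroupOf M).FG := by
  induction M using indec_induction with
  | equiv M N e h =>
    rwa [← le_antisymm (addSubgroupOf_mono (.of_equiv e))
      (addSubgroupOf_mono (.of_equiv e.symm))]
  | zero M h =>
    rw [addSubgroupOf_of_subsingleton h]
    exact AddSubgroup.FG.bot
  | indec M h =>
    rw [addSubgroupOf_of_isIndec h, AddSubgroup.zmultiples_eq_closure]
    exact ⟨{cls R M}, by simp⟩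
  | prod M N hM hN =>
    rw [addSubgroupOf_directSum]
    exact hM.sup hN

end Classes

end FinitelyGenerated

/-! ### Multiplicities of indecomposable summands -/

section Multiplicity

section Unbundled

variable {R : Type*} [Ring R] {X M N : Type*} [AddCommGroup X] [Module R X]
  [AddCommGroup M] [Module R M] [AddCommGroup N] [Module R N]

/-- `Hom(X, M)` as a right module over `End(X)`, acting by precomposition. -/
instance homModule : Module (Module.End R X)ᵐᵒᵖ (X →ₗ[R] M) where
  smul c f := f ∘ₗ c.unop
  one_smul _ := rfl
  mul_smul _ _ _ := rfl
  smul_zero _ := rfl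
  smul_add _ _ _ := rfl
  add_smul a b f := LinearMap.comp_add a.unop b.unop f
  zero_smul f := LinearMap.comp_zero f

/-- Composition with `u : M → N` as a map `Hom(X, M) → Hom(X, N)`, linear over `End(X)` acting by
precomposition. -/
def postcomp (X : Type*) [AddCommGroup X] [Module R X] (u : M →ₗ[R] N) :
    (X →ₗ[R] M) →ₗ[(Module.End R X)ᵐᵒᵖ] (X →ₗ[R] N) where
  toFun f := u ∘ₗ f
  map_add' f g := LinearMap.comp_add f g u
  map_smul' _ _ := rfl

variable [IsNoetherian R X] [IsArtinian R X]

/-- The radical of `Hom(X, M)` for an indecomposable module `X`: the homomorphisms that are not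
split monomorphisms. -/
def radHom (h : IsIndec R X) (M : Type*) [AddCommGroup M] [Module R M] :
    Submodule (Module.End R X)ᵐᵒᵖ (X →ₗ[R] M) where
  carrier := {f | ∀ g : M →ₗ[R] X, ¬ Function.Bijective (g ∘ₗ f)}
  add_mem' {f f'} hf hf' g hg := by
    rw [LinearMap.comp_add] at hg
    exact (h.bijective_or_bijective_of_add hg).elim (hf g) (hf' g)
  zero_mem' g hg := by
    have := h.nontrivial
    obtain ⟨x, hx⟩ := exists_ne (0 : X)
    exact hx (hg.1 (by simp))
  smul_mem' c f hf g hg := by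
    refine hf g ?_
    have h1 : Function.Bijective ((g ∘ₗ f) ∘ₗ c.unop) := hg
    have h2 : Function.Bijective c.unop :=
      IsArtinian.bijective_of_injective_endomorphism _
        (Function.Injective.of_comp (f := g ∘ₗ f) h1.1)
    exact (Function.Bijective.of_comp_iff _ h2).1 h1

/-- The multiplicity of the indecomposable module `X` as a direct summand of `M`: the length of
`Hom(X, M)` modulo the radical over `End(X)`, that is the dimension over the residue division ring
of `End(X)`. -/
noncomputable def mult (h : IsIndec R X) (M : Type*) [AddCommGroup M] [Module R M] : ℕ∞ :=
  Module.length (Module.End R X)ᵐᵒᵖ ((X →ₗ[R] M) ⧸ radHom h M)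

theorem mult_congr (h : IsIndec R X) (e : M ≃ₗ[R] N) : mult h M = mult h N := by
  let e' : (X →ₗ[R] M) ≃ₗ[(Module.End R X)ᵐᵒᵖ] (X →ₗ[R] N) :=
    .ofLinearMap (postcomp X e.toLinearMap) (postcomp X e.symm.toLinearMap)
      (by ext; simp [postcomp]) (by ext; simp [postcomp])
  refine (Submodule.Quotient.equiv (radHom h M) (radHom h N) e' ?_).length_eq
  ext f
  constructor
  · rintro ⟨f, hf, rfl⟩ g
    exact hf (g ∘ₗ e.toLinearMap)
  · intro hf
    refine ⟨e'.symm f, fun g hg => ?_, e'.apply_symm_apply f⟩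
    exact hf (g ∘ₗ e.symm.toLinearMap) hg

theorem mult_prod (h : IsIndec R X) : mult h (M × N) = mult h M + mult h N := by
  let φ : (X →ₗ[R] M × N) →ₗ[(Module.End R X)ᵐᵒᵖ]
      ((X →ₗ[R] M) ⧸ radHom h M) × ((X →ₗ[R] N) ⧸ radHom h N) :=
    ((radHom h M).mkQ ∘ₗ postcomp X (LinearMap.fst R M N)).prod
      ((radHom h N).mkQ ∘ₗ postcomp X (LinearMap.snd R M N))
  have hφ : Function.Surjective φ := by
    rintro ⟨a, b⟩
    obtain ⟨f, rfl⟩ := (radHom h M).mkQ_surjective a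
    obtain ⟨g, rfl⟩ := (radHom h N).mkQ_surjective b
    exact ⟨f.prod g, rfl⟩
  have hk : LinearMap.ker φ = radHom h (M × N) := by
    ext f
    have h1 : f ∈ LinearMap.ker φ ↔
        LinearMap.fst R M N ∘ₗ f ∈ radHom h M ∧ LinearMap.snd R M N ∘ₗ f ∈ radHom h N := by
      rw [LinearMap.ker_prod, LinearMap.ker_comp, LinearMap.ker_comp, Submodule.ker_mkQ,
        Submodule.ker_mkQ]
      rfl
    rw [h1]
    constructor
    · rintro ⟨h2, h3⟩ g hg
      have h4 : g ∘ₗ f = (g ∘ₗ LinearMap.inl R M N) ∘ₗ (LinearMap.fst R M N ∘ₗ f) +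
          (g ∘ₗ LinearMap.inr R M N) ∘ₗ (LinearMap.snd R M N ∘ₗ f) := by
        ext x
        simp only [LinearMap.add_apply, LinearMap.comp_apply, ← map_add]
        simp
      rw [h4] at hg
      exact (h.bijective_or_bijective_of_add hg).elim (h2 _) (h3 _)
    · exact fun hf => ⟨fun g => hf (g ∘ₗ LinearMap.fst R M N),
        fun g => hf (g ∘ₗ LinearMap.snd R M N)⟩
  rw [mult, mult, mult, ← Module.length_prod, ← hk]
  exact (φ.quotKerEquivOfSurjective hφ).length_eq

theorem mult_eq_zero_iff (h : IsIndec R X) : mult h M = 0 ↔ ¬ IsSummand R X M := by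
  rw [mult, Module.length_eq_zero_iff, Submodule.Quotient.subsingleton_iff,
    Submodule.eq_top_iff']
  constructor
  · rintro h1 ⟨i, r, hir⟩
    exact h1 i r (hir ▸ Function.bijective_id)
  · exact fun h1 f g hg => h1 (.of_bijective hg)

theorem mult_self (h : IsIndec R X) : mult h X = 1 := by
  rw [mult, Module.length_eq_one_iff, isSimpleModule_iff_toSpanSingleton_surjective]
  refine ⟨?_, fun m hm => ?_⟩
  · rw [← not_subsingleton_iff_nontrivial, ←
      Module.length_eq_zero_iff (R := (Module.End R X)ᵐᵒᵖ)]
    exact fun h1 => (mult_eq_zero_iff h).1 h1 .refl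
  · obtain ⟨f, rfl⟩ := (radHom h X).mkQ_surjective m
    intro y
    obtain ⟨f', rfl⟩ := (radHom h X).mkQ_surjective y
    have hf : f ∉ radHom h X := fun h1 => hm ((Submodule.Quotient.mk_eq_zero _).2 h1)
    obtain ⟨g, hg⟩ : ∃ g : X →ₗ[R] X, Function.Bijective (g ∘ₗ f) := by
      by_contra hcon
      exact hf fun g hg => hcon ⟨g, hg⟩
    let e := LinearEquiv.ofBijective f (IsArtinian.bijective_of_injective_endomorphism _
      (Function.Injective.of_comp hg.1))
    refine ⟨MulOpposite.op (e.symm.toLinearMap ∘ₗ f' : Module.End R X), ?_⟩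
    rw [LinearMap.toSpanSingleton_apply, ← map_smul]
    congr 1
    ext x
    exact e.apply_symm_apply (f' x)

end Unbundled

variable {R : Type u} [Ring R] [IsArtinianRing R] {X M N : Type u} [AddCommGroup X] [Module R X]
  [Module.Finite R X] [AddCommGroup M] [Module R M] [Module.Finite R M]
  [AddCommGroup N] [Module R N] [Module.Finite R N]

theorem mult_ne_top (h : IsIndec R X) (M : FGMod R) : mult h M ≠ ⊤ := by
  induction M using indec_induction with
  | equiv M N e hM => rwa [← mult_congr h e]
  | zero M hM =>
    rw [(mult_eq_zero_iff h).2]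
    · exact ENat.zero_ne_top
    · rintro ⟨i, r, hir⟩
      have := h.nontrivial
      have : Subsingleton X := (Function.LeftInverse.injective (g := r) (f := i)
        fun x => LinearMap.congr_fun hir x).subsingleton
      exact not_subsingleton X this
  | indec M hM =>
    by_cases hs : IsSummand R X M
    · have := h.nontrivial
      obtain ⟨e⟩ := hs.nonempty_equiv hM
      rw [mult_congr h e, mult_self]
      exact ENat.one_ne_top
    · rw [(mult_eq_zero_iff h).2 hs]
      exact ENat.zero_ne_top
  | prod M N hM hN =>
    have : mult h (directSum M N) = mult h M + mult h N := mult_prod h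
    rw [this]
    exact WithTop.add_ne_top.2 ⟨hM, hN⟩

/-- The multiplicity of a nonprojective indecomposable module `X`, as a homomorphism
`K₀ → ℤ`. -/
noncomputable def multHom (h : IsIndec R X) (hX : ¬ Module.Projective R X) : K0 R →+ ℤ :=
  QuotientAddGroup.lift (AddSubgroup.closure (k0Relators R))
    (FreeAbelianGroup.lift fun M : FGMod R => ((mult h M).toNat : ℤ)) <| by
      rw [AddSubgroup.closure_le]
      rintro _ (⟨M, M', M'', ⟨e⟩, rfl⟩ | ⟨P, hP, rfl⟩)
      · have h1 : mult h M = mult h M' + mult h M'' := by rw [mult_congr h e, mult_prod]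
        simp [AddMonoidHom.mem_ker, h1, ENat.toNat_add (mult_ne_top h M') (mult_ne_top h M'')]
      · have h1 : mult h P = 0 := (mult_eq_zero_iff h).2 fun hs => hX hs.projective
        simp [AddMonoidHom.mem_ker, h1]

theorem multHom_cls (h : IsIndec R X) (hX : ¬ Module.Projective R X) :
    multHom h hX (cls R M) = (mult h M).toNat := by
  change FreeAbelianGroup.lift _ (FreeAbelianGroup.of (FGModuleCat.of R M)) = _
  rw [FreeAbelianGroup.lift_apply_of]

theorem multHom_cls_self (h : IsIndec R X) (hX : ¬ Module.Projective R X) :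
    multHom h hX (cls R X) = 1 := by
  rw [multHom_cls, mult_self]; rfl

theorem multHom_cls_eq_zero_iff (h : IsIndec R X) (hX : ¬ Module.Projective R X) :
    multHom h hX (cls R M) = 0 ↔ ¬ IsSummand R X M := by
  rw [multHom_cls, Nat.cast_eq_zero, ENat.toNat_eq_zero, mult_eq_zero_iff]
  exact or_iff_left (mult_ne_top h (FGModuleCat.of R M))

theorem exists_indec_summand_of_not_projective (M : FGMod R) (hM : ¬ Module.Projective R M) :
    ∃ X : FGMod R, IsIndec R X ∧ ¬ Module.Projective R X ∧ IsSummand R X M := by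
  induction M using indec_induction with
  | equiv M N e h =>
    obtain ⟨X, h1, h2, h3⟩ := h fun hp => hM (.of_equiv e)
    exact ⟨X, h1, h2, h3.trans (.of_equiv e)⟩
  | zero M h => exact (hM inferInstance).elim
  | indec M h => exact ⟨M, h, hM, .refl⟩
  | prod M N h h' =>
    by_cases hp : Module.Projective R M
    · by_cases hp' : Module.Projective R N
      · exact (hM (inferInstanceAs (Module.Projective R (M × N)))).elim
      · obtain ⟨X, h1, h2, h3⟩ := h' hp'
        exact ⟨X, h1, h2, h3.trans .snd⟩
    · obtain ⟨X, h1, h2, h3⟩ := h hp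
      exact ⟨X, h1, h2, h3.trans .fst⟩

/-- A nonzero multiple of `[M]` vanishes in `K₀` only if `M` is projective. -/
theorem projective_of_zsmul_cls_eq_zero {n : ℤ} (hn : n ≠ 0) (h : n • cls R M = 0) :
    Module.Projective R M := by
  by_contra hM
  obtain ⟨X, h1, h2, h3⟩ :=
    exists_indec_summand_of_not_projective (FGModuleCat.of R M) hM
  have h4 := congrArg (multHom h1 h2) h
  rw [map_zsmul, map_zero, smul_eq_zero] at h4
  exact (multHom_cls_eq_zero_iff h1 h2).1 (h4.resolve_left hn) h3

theorem projective_of_cls_eq_zero (h : cls R M = 0) : Module.Projective R M :=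
  projective_of_zsmul_cls_eq_zero one_ne_zero (by rw [h, smul_zero])

/-- Modules with the same class in `K₀` are stably isomorphic. -/
theorem stably_iso_of_cls_eq (h : cls R M = cls R N) :
    ∃ P Q : FGMod R, Module.Projective R P ∧ Module.Projective R Q ∧
      Nonempty ((M × P) ≃ₗ[R] (N × Q)) := by
  -- induction on the length of `M`, splitting off a common indecomposable summand
  suffices H : ∀ (n : ℕ) (M N : FGMod R), Module.length R M ≤ n → cls R M = cls R N →
      ∃ P Q : FGMod R, Module.Projective R P ∧ Module.Projective R Q ∧
        Nonempty ((M × P) ≃ₗ[R] (N × Q)) by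
    have hl : Module.length R M ≠ ⊤ := Module.length_ne_top
    exact H (Module.length R M).toNat (FGModuleCat.of R M) (FGModuleCat.of R N)
      (ENat.natCast_toNat hl).ge h
  have hproj : ∀ M N : FGMod R, Module.Projective R M → cls R M = cls R N →
      ∃ P Q : FGMod R, Module.Projective R P ∧ Module.Projective R Q ∧
        Nonempty ((M × P) ≃ₗ[R] (N × Q)) := fun M N hM h => by
    rw [cls_of_projective] at h
    exact ⟨N, M, projective_of_cls_eq_zero h.symm, hM, ⟨LinearEquiv.prodComm R M N⟩⟩
  intro n
  induction n with
  | zero =>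
    intro M N hM h
    have : Subsingleton M :=
      Module.length_eq_zero_iff.1 (le_antisymm (by simpa using hM) bot_le)
    exact hproj M N inferInstance h
  | succ n ih =>
    intro M N hM h
    by_cases hp : Module.Projective R M
    · exact hproj M N hp h
    obtain ⟨X, hX, hXp, hXM⟩ := exists_indec_summand_of_not_projective M hp
    have hXN : IsSummand R X N := by
      have h1 := mt (multHom_cls_eq_zero_iff (M := M) hX hXp).1 (not_not.2 hXM)
      rw [h] at h1
      by_contra h2
      exact h1 ((multHom_cls_eq_zero_iff hX hXp).2 h2)
    obtain ⟨i, r, hir⟩ := hXM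
    obtain ⟨j, s, hjs⟩ := hXN
    obtain ⟨e⟩ := exists_equiv_prod_ker hir
    obtain ⟨e'⟩ := exists_equiv_prod_ker hjs
    have h1 : cls R (LinearMap.ker r) = cls R (LinearMap.ker s) := by
      rw [cls_congr e, cls_congr e', cls_prod, cls_prod] at h
      exact add_left_cancel h
    have hl : Module.length R (LinearMap.ker r) ≤ n := by
      have h2 : LinearMap.ker r ≠ ⊤ := fun h2 => by
        have := hX.nontrivial
        obtain ⟨x, hx⟩ := exists_ne (0 : X)
        have h3 : r (i x) = x := LinearMap.congr_fun hir x
        rw [LinearMap.ker_eq_top.1 h2] at h3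
        exact hx h3.symm
      have h3 := (Submodule.length_lt h2).trans_le hM
      push_cast at h3
      exact ENat.lt_natCast_add_one_iff.1 h3
    obtain ⟨P, Q, hP, hQ, ⟨f⟩⟩ :=
      ih (FGModuleCat.of R (LinearMap.ker r)) (FGModuleCat.of R (LinearMap.ker s)) hl h1
    refine ⟨P, Q, hP, hQ, ⟨?_⟩⟩
    exact (e.prodCongr (.refl R P)).trans <| (LinearEquiv.prodAssoc R X _ P).trans <|
      ((LinearEquiv.refl R X).prodCongr f).trans <| (LinearEquiv.prodAssoc R X _ Q).symm.trans <|
      (e'.prodCongr (.refl R Q)).symm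

end Multiplicity

/-! ### Nilpotency orders and the value `m - 1` -/

section Phi

variable {R : Type u} [Ring R] [IsArtinianRing R]

variable (R) in
/-- `omegaBar` as a homomorphism of additive groups; its powers are written as iterates. -/
noncomputable def syzygyHom : K0 R →+ K0 R := omegaBar R

theorem syzygyHom_cls {P M : Type u} [AddCommGroup M] [Module R M] [Module.Finite R M]
    [AddCommGroup P] [Module R P] [Module.Finite R P] [hP : Module.Projective R P]
    (f : P →ₗ[R] M) (hf : Function.Surjective f) :
    syzygyHom R (cls R M) = cls R (LinearMap.ker f) := by
  refine (omegaBar_k0Class (FGModuleCat.of R M)).trans ?_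
  exact k0Class_syzygy (P := FGModuleCat.of R P) (M := FGModuleCat.of R M) hP f hf

theorem syzygyHom_cls_quotient {P : Type u} [AddCommGroup P] [Module R P] [Module.Finite R P]
    [Module.Projective R P] (K : Submodule R P) :
    syzygyHom R (cls R (P ⧸ K)) = cls R K := by
  rw [syzygyHom_cls K.mkQ K.mkQ_surjective]
  exact cls_congr (LinearEquiv.ofEq _ _ K.ker_mkQ)

theorem omegaBar_pow_apply (n : ℕ) (x : K0 R) :
    (omegaBar R ^ n) x = (syzygyHom R)^[n] x := by
  induction n with
  | zero => rfl
  | succ n ih =>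
    rw [Function.iterate_succ_apply', ← ih, pow_succ']
    rfl

/-- The values admitted in the definition of `φ(M)` are those bounding the order of nilpotency of
the elements of `⟨add M⟩` killed by a power of `Ω̄`. -/
theorem injOn_iff_iterate_eq_zero (G : AddSubgroup (K0 R)) (l : ℕ) :
    (∀ s : ℕ, Set.InjOn (omegaBar R) (G.map (omegaBar R ^ (l + s)) : AddSubgroup (K0 R))) ↔
      ∀ g ∈ G, ∀ n, (syzygyHom R)^[n] g = 0 → (syzygyHom R)^[l] g = 0 := by
  have hG : ∀ n, (G.map (omegaBar R ^ n) : Set (K0 R)) = (syzygyHom R)^[n] '' G := fun n =>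
    Set.image_congr fun x _ => omegaBar_pow_apply n x
  have hS : ∀ n, Set.InjOn (omegaBar R) (G.map (omegaBar R ^ n) : AddSubgroup (K0 R)) ↔
      Set.InjOn (syzygyHom R) ((syzygyHom R)^[n] '' G) := fun n => by
    rw [← hG]
    rfl
  refine (forall_congr' fun s => hS (l + s)).trans ?_
  constructor
  · intro h g hg n
    induction n with
    | zero =>
      intro h0
      rw [show g = 0 from h0, iterate_map_zero]
    | succ n ih =>
      intro h0
      rcases le_or_gt (n + 1) l with hl | hl
      · obtain ⟨d, rfl⟩ := Nat.exists_eq_add_of_le' hl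
        rw [Function.iterate_add_apply, h0, iterate_map_zero]
      · obtain ⟨s, rfl⟩ := Nat.exists_eq_add_of_le (Nat.lt_succ_iff.1 hl)
        refine ih (h s ⟨g, hg, rfl⟩ ⟨0, zero_mem G, iterate_map_zero _ _⟩ ?_)
        rw [map_zero, ← h0, Function.iterate_succ_apply']
  · rintro h s _ ⟨a, ha, rfl⟩ _ ⟨b, hb, rfl⟩ hab
    have h1 : (syzygyHom R)^[l] (a - b) = 0 := by
      refine h _ (sub_mem ha hb) (l + s + 1) ?_
      rw [iterate_map_sub, Function.iterate_succ_apply', Function.iterate_succ_apply', hab,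
        sub_self]
    rw [← sub_eq_zero, ← iterate_map_sub, add_comm, Function.iterate_add_apply, h1,
      iterate_map_zero]

/-- The kernels of the powers of `Ω̄` stabilise on a finitely generated subgroup. -/
theorem exists_iterate_eq_zero_bound {G : AddSubgroup (K0 R)} (hG : G.FG) :
    ∃ l, ∀ g ∈ G, ∀ n, (syzygyHom R)^[n] g = 0 → (syzygyHom R)^[l] g = 0 := by
  have : Module.Finite ℤ (AddSubgroup.toIntSubmodule G) := by
    rw [Module.Finite.iff_fg, Submodule.fg_iff_addSubgroup_fg]
    exact hG
  have hmem : ∀ (n : ℕ) (x : AddSubgroup.toIntSubmodule G),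
      x ∈ (AddSubgroup.toIntSubmodule (AddMonoidHom.ker (omegaBar R ^ n))).comap
        (AddSubgroup.toIntSubmodule G).subtype ↔ (syzygyHom R)^[n] x = 0 := fun n x => by
    rw [← omegaBar_pow_apply]
    rfl
  let K : ℕ →o Submodule ℤ (AddSubgroup.toIntSubmodule G) :=
    ⟨fun n => (AddSubgroup.toIntSubmodule (AddMonoidHom.ker (omegaBar R ^ n))).comap
      (AddSubgroup.toIntSubmodule G).subtype, by
      refine monotone_nat_of_le_succ fun n x hx => ?_
      rw [hmem] at hx ⊢
      rw [Function.iterate_succ_apply', hx, map_zero]⟩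
  obtain ⟨l, hl⟩ := monotone_stabilizes_iff_noetherian.2 inferInstance K
  refine ⟨l, fun g hg n hn => ?_⟩
  have h1 : (⟨g, hg⟩ : AddSubgroup.toIntSubmodule G) ∈ K n := (hmem n _).2 hn
  refine (hmem l ⟨g, hg⟩).1 (?_ : _ ∈ K l)
  rcases le_total l n with h | h
  · rwa [hl n h]
  · exact K.monotone h h1

theorem phi_le_iff {M : FGMod R} {l : ℕ} :
    phi M ≤ l ↔ ∀ g ∈ addSubgroupOf M, ∀ n, (syzygyHom R)^[n] g = 0 →
      (syzygyHom R)^[l] g = 0 := by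
  have h1 := exists_iterate_eq_zero_bound (addSubgroupOf_fg M)
  simp only [phi, injOn_iff_iterate_eq_zero]
  constructor
  · intro h g hg n hn
    have h2 := Nat.sInf_mem (s := {l | ∀ g ∈ addSubgroupOf M, ∀ n, (syzygyHom R)^[n] g = 0 →
      (syzygyHom R)^[l] g = 0}) h1 g hg n hn
    obtain ⟨d, hd⟩ := Nat.exists_eq_add_of_le' h
    rw [hd, Function.iterate_add_apply, h2, iterate_map_zero]
  · exact fun h => Nat.sInf_le h

theorem phi_eq_one {M : FGMod R} {x : K0 R} (hx : x ∈ addSubgroupOf M) (hx0 : x ≠ 0)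
    (hTx : syzygyHom R x = 0)
    (h : ∀ g ∈ addSubgroupOf M, ∀ n, (syzygyHom R)^[n] g = 0 → syzygyHom R g = 0) :
    phi M = 1 := by
  refine le_antisymm (phi_le_iff.2 fun g hg n hn => ?_) (Nat.one_le_iff_ne_zero.2 fun h0 => ?_)
  · exact h g hg n hn
  · exact hx0 (phi_le_iff.1 h0.le x hx 1 hTx)

theorem exists_syzygyHom_eq_zero (h : 0 < phiDim R) : ∃ x : K0 R, x ≠ 0 ∧ syzygyHom R x = 0 := by
  by_contra hcon
  push Not at hcon
  refine h.ne' (le_antisymm (iSup_le fun M => ?_) bot_le)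
  have : phi M ≤ 0 := phi_le_iff.2 fun g _ n hn => by
    induction n with
    | zero => exact hn
    | succ n ih =>
      refine ih (by_contra fun h1 => hcon _ h1 ?_)
      rw [← hn, Function.iterate_succ_apply']
  exact_mod_cast this

/-- The syzygies of the indecomposable summands of `M` add up to a submodule of a projective
module. -/
theorem exists_map_addSubgroupOf_le (M : FGMod R) :
    ∃ (P : FGMod R) (N : Submodule R P), Module.Projective R P ∧
      (addSubgroupOf M).map (syzygyHom R) ≤ addSubgroupOf (FGModuleCat.of R N) := by
  induction M using indec_induction with
  | equiv M N e h =>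
    rwa [← le_antisymm (addSubgroupOf_mono (.of_equiv e))
      (addSubgroupOf_mono (.of_equiv e.symm))]
  | zero M h =>
    refine ⟨M, ⊥, inferInstance, ?_⟩
    rw [addSubgroupOf_of_subsingleton h, AddSubgroup.map_bot]
    exact bot_le
  | indec M h =>
    obtain ⟨P, f, hf⟩ := exists_isProjectiveCover M
    have := hf.projective
    refine ⟨P, LinearMap.ker f, hf.projective, ?_⟩
    rw [addSubgroupOf_of_isIndec h, AddMonoidHom.map_zmultiples, AddSubgroup.zmultiples_le]
    rw [syzygyHom_cls f hf.surjective]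
    exact cls_mem_addSubgroupOf_self (FGModuleCat.of R (LinearMap.ker f))
  | prod M M' h h' =>
    obtain ⟨P, N, hP, hN⟩ := h
    obtain ⟨P', N', hP', hN'⟩ := h'
    refine ⟨directSum P P', N.prod N', inferInstanceAs (Module.Projective R (P × P')), ?_⟩
    rw [addSubgroupOf_directSum, AddSubgroup.map_sup]
    refine (sup_le_sup hN hN').trans ?_
    rw [← addSubgroupOf_directSum]
    let e : (N × N') ≃ₗ[R] N.prod N' :=
      { toFun := fun y => ⟨(y.1, y.2), y.1.2, y.2.2⟩
        invFun := fun x => (⟨x.1.1, x.2.1⟩, ⟨x.1.2, x.2.2⟩)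
        map_add' := fun _ _ => rfl
        map_smul' := fun _ _ => rfl
        left_inv := fun _ => rfl
        right_inv := fun _ => rfl }
    exact addSubgroupOf_mono (.of_equiv e)

/-- Every torsionless module `N` has its summands among the syzygies: a summand embedded in a
projective module `P` is the syzygy of its cokernel. -/
theorem exists_addSubgroupOf_le_map (N P : FGMod R) (hP : Module.Projective R P)
    (i : N →ₗ[R] P) (hi : Function.Injective i) :
    ∃ Z : FGMod R, addSubgroupOf N ≤ (addSubgroupOf Z).map (syzygyHom R) := by
  induction N using indec_induction with
  | equiv M N e h =>
    rw [← le_antisymm (addSubgroupOf_mono (.of_equiv e))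
      (addSubgroupOf_mono (.of_equiv e.symm))]
    exact h (i ∘ₗ e.toLinearMap) (hi.comp e.injective)
  | zero N h => exact ⟨N, by rw [addSubgroupOf_of_subsingleton h]; exact bot_le⟩
  | indec N h =>
    let K := LinearMap.range i
    refine ⟨FGModuleCat.of R (P ⧸ K), ?_⟩
    rw [addSubgroupOf_of_isIndec h, AddSubgroup.zmultiples_le]
    refine ⟨_, cls_mem_addSubgroupOf_self _, (syzygyHom_cls_quotient K).trans ?_⟩
    exact (cls_congr (LinearEquiv.ofInjective i hi)).symm
  | prod N N' h h' =>
    obtain ⟨Z, hZ⟩ := h (i ∘ₗ LinearMap.inl R N N') (hi.comp LinearMap.inl_injective)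
    obtain ⟨Z', hZ'⟩ := h' (i ∘ₗ LinearMap.inr R N N') (hi.comp LinearMap.inr_injective)
    refine ⟨directSum Z Z', ?_⟩
    rw [addSubgroupOf_directSum, addSubgroupOf_directSum, AddSubgroup.map_sup]
    exact sup_le_sup hZ hZ'

/-- If `m > 0` is the `φ`-dimension, then `φ` takes the value `m - 1`: it is attained at the sum
of the syzygies of the indecomposable summands of a module of `φ`-value `m`. -/
theorem exists_phi_eq_sub_one {m : ℕ} (hm : 0 < m) (h : phiDim R = m) :
    ∃ N : FGMod R, phi N = m - 1 := by
  have hle : ∀ M : FGMod R, phi M ≤ m := fun M => by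
    have h1 : (phi M : ℕ∞) ≤ phiDim R := le_iSup (fun M : FGMod R => (phi M : ℕ∞)) M
    rw [h] at h1
    exact_mod_cast h1
  obtain ⟨M, hM⟩ : ∃ M : FGMod R, ¬ phi M ≤ m - 1 := by
    by_contra hcon
    push Not at hcon
    have h1 : phiDim R ≤ ((m - 1 : ℕ) : ℕ∞) := iSup_le fun M => by exact_mod_cast hcon M
    rw [h] at h1
    have : m ≤ m - 1 := by exact_mod_cast h1
    omega
  rw [phi_le_iff] at hM
  push Not at hM
  obtain ⟨g, hg, n, hn, hg0⟩ := hM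
  obtain ⟨P, N, hP, hN⟩ := exists_map_addSubgroupOf_le M
  obtain ⟨Z, hZ⟩ := exists_addSubgroupOf_le_map (FGModuleCat.of R N) P hP N.subtype
    N.subtype_injective
  refine ⟨FGModuleCat.of R N, le_antisymm (phi_le_iff.2 fun x hx k hk => ?_) ?_⟩
  · obtain ⟨z, hz, rfl⟩ := hZ hx
    rw [← Function.iterate_succ_apply] at hk ⊢
    rw [Nat.succ_eq_add_one, Nat.sub_add_cancel hm]
    exact phi_le_iff.1 (hle Z) z hz _ hk
  · by_contra hlt
    push Not at hlt
    obtain ⟨d, hd⟩ : ∃ d, m - 1 = d + 1 := ⟨m - 2, by omega⟩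
    rw [hd] at hlt hg0
    refine hg0 ?_
    rw [Function.iterate_succ_apply]
    refine phi_le_iff.1 (Nat.lt_succ_iff.1 hlt) _ (hN ⟨g, hg, rfl⟩) n ?_
    rw [← Function.iterate_succ_apply, Function.iterate_succ_apply', hn, map_zero]

end Phi

/-! ### Pairs of modules with `φ`-value `1` -/

section Pairs

variable {R : Type u} [Ring R] [IsArtinianRing R]

theorem exists_syzygyHom_cls_eq (M : FGMod R) : ∃ K : FGMod R, syzygyHom R (cls R M) = cls R K :=
  ⟨syzygy M, omegaBar_k0Class M⟩

theorem syzygyHom_cls_eq_zero_of_isSummand {M Y : FGMod R} (h : IsSummand R Y M)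
    (hM : syzygyHom R (cls R M) = 0) : syzygyHom R (cls R Y) = 0 := by
  obtain ⟨i, r, hir⟩ := h
  obtain ⟨e⟩ := exists_equiv_prod_ker hir
  obtain ⟨K, hK⟩ := exists_syzygyHom_cls_eq Y
  obtain ⟨K', hK'⟩ := exists_syzygyHom_cls_eq (FGModuleCat.of R (LinearMap.ker r))
  have h1 : cls R (K × K') = 0 := by
    rw [cls_prod, ← hK, ← hK', ← map_add, ← hM, cls_congr e, cls_prod]
  have := projective_of_cls_eq_zero h1
  have : Module.Projective R K := (IsSummand.fst (R := R) (X := K) (Y := K')).projective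
  rw [hK, cls_of_projective]

/-- The double of an indecomposable nonprojective module with projective syzygy has `φ`-value
`1`. -/
theorem phi_directSum_self {Y : FGMod R} (hY : IsIndec R Y) (hp : ¬ Module.Projective R Y)
    (h : syzygyHom R (cls R Y) = 0) : phi (directSum Y Y) = 1 := by
  refine phi_eq_one (x := cls R Y) ?_ (fun h0 => hp (projective_of_cls_eq_zero h0)) h
    fun g hg _ _ => ?_
  · exact cls_mem_addSubgroupOf hY .fst
  · rw [addSubgroupOf_directSum, sup_idem, addSubgroupOf_of_isIndec hY] at hg
    obtain ⟨c, rfl⟩ := hg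
    change syzygyHom R (c • cls R Y) = 0
    rw [map_zsmul, h, smul_zero]

/-- If no nonprojective module has a projective syzygy, then the classes of nonprojective modules
are not killed by the powers of `Ω̄`. -/
theorem syzygyHom_iterate_zsmul_ne_zero
    (hB : ∀ M : FGMod R, syzygyHom R (cls R M) = 0 → Module.Projective R M) (n : ℕ) :
    ∀ (M : FGMod R) (c : ℤ), ¬ Module.Projective R M → c ≠ 0 →
      (syzygyHom R)^[n] (c • cls R M) ≠ 0 := by
  induction n with
  | zero => exact fun M c hM hc h => hM (projective_of_zsmul_cls_eq_zero hc h)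
  | succ n ih =>
    intro M c hM hc
    obtain ⟨K, hK⟩ := exists_syzygyHom_cls_eq M
    rw [Function.iterate_succ_apply, map_zsmul, hK]
    refine ih K c (fun hp => hM (hB M ?_)) hc
    rw [hK, cls_of_projective]

/-- Two nonisomorphic indecomposable modules of infinite projective dimension, the syzygy class of
one being a multiple of that of the other, have a direct sum of `φ`-value `1`. -/
theorem phi_directSum_eq_one
    (hB : ∀ M : FGMod R, syzygyHom R (cls R M) = 0 → Module.Projective R M)
    {M₁ M₂ : FGMod R} (h₁ : IsIndec R M₁) (h₂ : IsIndec R M₂)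
    (hp₁ : ¬ Module.Projective R M₁) (hp₂ : ¬ Module.Projective R M₂)
    (hne : ¬ Nonempty (M₁ ≃ₗ[R] M₂)) (n : ℕ)
    (hT : syzygyHom R (cls R M₁) = n • syzygyHom R (cls R M₂)) :
    phi (directSum M₁ M₂) = 1 := by
  have hG : addSubgroupOf (directSum M₁ M₂) =
      AddSubgroup.zmultiples (cls R M₁) ⊔ AddSubgroup.zmultiples (cls R M₂) := by
    rw [addSubgroupOf_directSum, addSubgroupOf_of_isIndec h₁, addSubgroupOf_of_isIndec h₂]
  refine phi_eq_one (x := cls R M₁ - n • cls R M₂) ?_ (fun h0 => ?_) ?_ fun g hg k hk => ?_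
  · rw [hG]
    exact sub_mem (AddSubgroup.mem_sup_left (AddSubgroup.mem_zmultiples _))
      (AddSubgroup.mem_sup_right (nsmul_mem (AddSubgroup.mem_zmultiples _) n))
  · have h3 : multHom h₁ hp₁ (cls R M₂) = 0 := by
      rw [multHom_cls_eq_zero_iff]
      intro hs
      have := h₁.nontrivial
      obtain ⟨e⟩ := hs.nonempty_equiv h₂
      exact hne ⟨e.symm⟩
    have h4 := congrArg (multHom h₁ hp₁) h0
    rw [map_sub, map_nsmul, h3, multHom_cls_self, map_zero] at h4
    simp at h4
  · rw [map_sub, map_nsmul, hT, sub_self]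
  · rw [hG] at hg
    obtain ⟨_, ⟨a, rfl⟩, _, ⟨b, rfl⟩, rfl⟩ := AddSubgroup.mem_sup.1 hg
    change (syzygyHom R)^[k] (a • cls R M₁ + b • cls R M₂) = 0 at hk
    change syzygyHom R (a • cls R M₁ + b • cls R M₂) = 0
    have h3 : syzygyHom R (a • cls R M₁ + b • cls R M₂) =
        syzygyHom R ((a * n + b) • cls R M₂) := by
      simp only [map_add, map_zsmul, map_nsmul, hT, add_smul, mul_smul, natCast_zsmul]
    by_cases hc : a * n + b = 0
    · rw [h3, hc, zero_smul, map_zero]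
    · refine (syzygyHom_iterate_zsmul_ne_zero hB (k + 1) M₂ _ hp₂ hc ?_).elim
      rw [Function.iterate_succ_apply, ← h3, ← Function.iterate_succ_apply,
        Function.iterate_succ_apply', hk, map_zero]

variable (R) in
/-- The situation in which no direct sum of two indecomposable modules has `φ`-value `1` for an
evident reason: a module with projective syzygy is projective, and an indecomposable nonprojective
module is determined by its syzygy class, even up to multiples. -/
structure SyzygyRigid : Prop where
  projective_of_syzygy : ∀ M : FGMod R, syzygyHom R (cls R M) = 0 → Module.Projective R M
  equiv_of_syzygy : ∀ (M₁ M₂ : FGMod R) (n : ℕ), IsIndec R M₁ → IsIndec R M₂ →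
    ¬ Module.Projective R M₁ → ¬ Module.Projective R M₂ →
    syzygyHom R (cls R M₁) = n • syzygyHom R (cls R M₂) → Nonempty (M₁ ≃ₗ[R] M₂)

theorem syzygyRigid_or_exists_phi_eq_one :
    SyzygyRigid R ∨ ∃ M₁ M₂ : FGMod R, IsIndec R M₁ ∧ IsIndec R M₂ ∧
      phi (directSum M₁ M₂) = 1 := by
  by_cases hB : ∀ M : FGMod R, syzygyHom R (cls R M) = 0 → Module.Projective R M
  · refine or_iff_not_imp_right.2 fun hcon => ⟨hB, fun M₁ M₂ n h₁ h₂ hp₁ hp₂ hT => ?_⟩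
    by_contra hne
    exact hcon ⟨M₁, M₂, h₁, h₂, phi_directSum_eq_one hB h₁ h₂ hp₁ hp₂ hne n hT⟩
  · push Not at hB
    obtain ⟨M, hM, hp⟩ := hB
    obtain ⟨Y, hY, hYp, hs⟩ := exists_indec_summand_of_not_projective M hp
    exact Or.inr ⟨Y, Y, hY, hY,
      phi_directSum_self hY hYp (syzygyHom_cls_eq_zero_of_isSummand hs hM)⟩

end Pairs

/-! ### Local modules -/

section Local

/-- `m` is the greatest proper submodule of its ambient module. -/
structure IsGreatestProper {R M : Type*} [Ring R] [AddCommGroup M] [Module R M]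
    (m : Submodule R M) : Prop where
  ne_top : m ≠ ⊤
  le : ∀ N : Submodule R M, N ≠ ⊤ → N ≤ m

variable {R : Type*} [Ring R] {M P S : Type*} [AddCommGroup M] [Module R M] [AddCommGroup P]
  [Module R P] [AddCommGroup S] [Module R S]

theorem IsGreatestProper.isCoatom {m : Submodule R M} (h : IsGreatestProper m) : IsCoatom m :=
  ⟨h.ne_top, fun N hN => by_contra fun h1 => not_le_of_gt hN (h.le N h1)⟩

theorem IsGreatestProper.eq_of_isCoatom {m N : Submodule R M} (h : IsGreatestProper m)
    (hN : IsCoatom N) : N = m :=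
  (hN.le_iff.1 (h.le N hN.1)).resolve_left h.ne_top |>.symm

theorem IsGreatestProper.eq_top_of_sup {m N K : Submodule R M} (h : IsGreatestProper m)
    (hK : K ≠ ⊤) (hs : N ⊔ K = ⊤) : N = ⊤ := by
  by_contra hN
  exact h.ne_top (top_le_iff.1 (hs ▸ sup_le (h.le N hN) (h.le K hK)))

theorem IsGreatestProper.map_equiv {m : Submodule R M} (h : IsGreatestProper m)
    (e : M ≃ₗ[R] M) : m.map e.toLinearMap ≤ m := by
  refine h.le _ fun h1 => h.ne_top ?_
  rw [← Submodule.comap_map_eq_of_injective e.injective m]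
  erw [h1]
  exact Submodule.comap_top _

/-- Nonzero quotients of local modules are indecomposable. -/
theorem IsGreatestProper.isIndec_quotient {m K : Submodule R M} (h : IsGreatestProper m)
    (hK : K ≠ ⊤) : IsIndec R (M ⧸ K) := by
  have hc : ∀ p : Submodule R (M ⧸ K), p.comap K.mkQ = ⊤ → p = ⊤ := fun p hp => by
    rw [← Submodule.map_comap_eq_of_surjective K.mkQ_surjective p, hp, Submodule.map_top,
      Submodule.range_mkQ]
  refine ⟨Submodule.Quotient.nontrivial_iff.2 hK, fun p q hpq => ?_⟩
  by_cases hp : p = ⊤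
  · right
    rw [hp] at hpq
    simpa using hpq.inf_eq_bot
  · by_cases hq : q = ⊤
    · left
      rw [hq] at hpq
      simpa using hpq.inf_eq_bot
    · exfalso
      refine hp (hc p (h.eq_top_of_sup (mt (hc q) hq) (top_le_iff.1 fun x _ => ?_)))
      have hx : K.mkQ x ∈ p ⊔ q := hpq.sup_eq_top ▸ Submodule.mem_top
      obtain ⟨y, hy, z, hz, hyz⟩ := Submodule.mem_sup.1 hx
      obtain ⟨y, rfl⟩ := K.mkQ_surjective y
      have : x - y ∈ q.comap K.mkQ := by
        rw [Submodule.mem_comap, map_sub, ← hyz, add_sub_cancel_left]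
        exact hz
      rw [← add_sub_cancel y x]
      exact add_mem (Submodule.mem_sup_left hy) (Submodule.mem_sup_right this)

theorem IsGreatestProper.isIndec {m : Submodule R M} (h : IsGreatestProper m) : IsIndec R M := by
  have : (⊥ : Submodule R M) ≠ ⊤ := fun h1 => h.ne_top (top_le_iff.1 (h1 ▸ bot_le))
  exact (h.isIndec_quotient this).of_equiv (Submodule.quotEquivOfEqBot ⊥ rfl)

theorem IsProjectiveCover.isGreatestProper_ker [IsSimpleModule R S] {f : P →ₗ[R] S}
    (hf : IsProjectiveCover f) : IsGreatestProper (LinearMap.ker f) := by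
  have hc : IsCoatom (LinearMap.ker f) := LinearMap.isCoatom_ker_of_surjective hf.surjective
  refine ⟨hc.1, fun N hN => ?_⟩
  by_contra hle
  have : LinearMap.ker f < N ⊔ LinearMap.ker f := by
    refine lt_of_le_of_ne le_sup_right fun h1 => hle ?_
    rw [h1]
    exact le_sup_left
  exact hN (hf.superfluous N (hc.2 _ this))

/-- Isomorphic projective modules are projective covers of isomorphic simple modules. -/
theorem IsProjectiveCover.simple_equiv {P' S' : Type*} [AddCommGroup P'] [Module R P']
    [AddCommGroup S'] [Module R S']
    [IsSimpleModule R S] [IsSimpleModule R S'] {f : P →ₗ[R] S} {f' : P' →ₗ[R] S'}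
    (hf : IsProjectiveCover f) (hf' : IsProjectiveCover f') (e : P ≃ₗ[R] P') :
    Nonempty (S ≃ₗ[R] S') := by
  have hs : Function.Surjective (f' ∘ₗ e.toLinearMap) := hf'.surjective.comp e.surjective
  have h : LinearMap.ker (f' ∘ₗ e.toLinearMap) = LinearMap.ker f :=
    hf.isGreatestProper_ker.eq_of_isCoatom (LinearMap.isCoatom_ker_of_surjective hs)
  exact ⟨(f.quotKerEquivOfSurjective hf.surjective).symm.trans
    ((Submodule.quotEquivOfEq _ _ h.symm).trans (LinearMap.quotKerEquivOfSurjective _ hs))⟩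

variable [IsNoetherian R P] [IsArtinian R P]

/-- An indecomposable projective module of finite length is local. -/
theorem IsIndec.exists_isGreatestProper [Module.Projective R P] (h : IsIndec R P) :
    ∃ m : Submodule R P, IsGreatestProper m := by
  -- every proper submodule `N` is superfluous: the projection `P → P / N` lifts along
  -- `N' → P / N` to an endomorphism of `P` that is not nilpotent
  have key : ∀ N N' : Submodule R P, N ≠ ⊤ → N ⊔ N' = ⊤ → N' = ⊤ := by
    intro N N' hN hs
    have hsurj : Function.Surjective (N.mkQ ∘ₗ N'.subtype) := by
      intro y
      obtain ⟨x, rfl⟩ := N.mkQ_surjective y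
      obtain ⟨a, ha, b, hb, rfl⟩ := Submodule.mem_sup.1 (hs ▸ Submodule.mem_top : x ∈ N ⊔ N')
      refine ⟨⟨b, hb⟩, ?_⟩
      simp [(Submodule.Quotient.mk_eq_zero N).2 ha]
    obtain ⟨g₀, hg₀⟩ := Module.projective_lifting_property _ N.mkQ hsurj
    let g : Module.End R P := N'.subtype ∘ₗ g₀
    have hg : ∀ x, N.mkQ (g x) = N.mkQ x := fun x => LinearMap.congr_fun hg₀ x
    rcases h.bijective_or_isNilpotent g with h1 | ⟨n, hn⟩
    · rw [eq_top_iff]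
      intro x _
      obtain ⟨y, rfl⟩ := h1.2 x
      exact (g₀ y).2
    · refine (hN ?_).elim
      have h2 : ∀ n x, N.mkQ ((g ^ n) x) = N.mkQ x := by
        intro n
        induction n with
        | zero => exact fun x => rfl
        | succ n ih =>
          intro x
          rw [pow_succ, Module.End.mul_apply, ih, hg]
      rw [eq_top_iff]
      intro x _
      rw [← Submodule.Quotient.mk_eq_zero, ← Submodule.mkQ_apply, ← h2 n x, hn]
      simp
  have := h.nontrivial
  obtain ⟨m, hm, -⟩ := (IsCoatomic.eq_top_or_exists_le_coatom (⊥ : Submodule R P)).resolve_left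
    bot_ne_top
  refine ⟨m, hm.1, fun N hN => ?_⟩
  by_contra hle
  refine hN (key m N hm.1 (hm.2 _ (lt_of_le_of_ne le_sup_left fun h1 => hle ?_)))
  rw [h1]
  exact le_sup_right

end Local

/-! ### Socles of indecomposable projective modules -/

section Rigid

variable {R : Type u} [Ring R] [IsArtinianRing R]

theorem eq_bot_or_eq_top_of_projective_quotient {P : Type u} [AddCommGroup P] [Module R P]
    [Module.Finite R P] (hP : IsIndec R P) (N : Submodule R P)
    (h : Module.Projective R (P ⧸ N)) : N = ⊥ ∨ N = ⊤ := by
  refine or_iff_not_imp_right.2 fun hN => ?_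
  have : Nontrivial (P ⧸ N) := Submodule.Quotient.nontrivial_iff.2 hN
  obtain ⟨s, hs⟩ := Module.projective_lifting_property N.mkQ LinearMap.id N.mkQ_surjective
  obtain ⟨e⟩ := IsSummand.nonempty_equiv ⟨s, N.mkQ, hs⟩ hP
  have h1 : Function.Bijective (e.symm.toLinearMap ∘ₗ N.mkQ) :=
    IsNoetherian.bijective_of_surjective_endomorphism _ (e.symm.surjective.comp N.mkQ_surjective)
  rw [← N.ker_mkQ, LinearMap.ker_eq_bot]
  exact Function.Injective.of_comp (f := e.symm) h1.1

namespace SyzygyRigid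

variable {P P' : FGMod R}

theorem eq_bot_or_eq_top_of_projective (hR : SyzygyRigid R) (hP : IsIndec R P) [Module.Projective R P]
    (N : Submodule R P) (h : Module.Projective R N) : N = ⊥ ∨ N = ⊤ := by
  refine eq_bot_or_eq_top_of_projective_quotient hP N
    (hR.projective_of_syzygy (FGModuleCat.of R (P ⧸ N)) ?_)
  exact (syzygyHom_cls_quotient N).trans cls_of_projective

/-- Isomorphic submodules of indecomposable projective modules are conjugate under an isomorphism
of the projective modules. -/
theorem exists_equiv_map_eq (hR : SyzygyRigid R) (hP : IsIndec R P) (hP' : IsIndec R P') [Module.Projective R P]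
    [Module.Projective R P'] {N : Submodule R P} {N' : Submodule R P'} (h0 : N ≠ ⊥)
    (h1 : N ≠ ⊤) (h1' : N' ≠ ⊤) (e : N ≃ₗ[R] N') :
    ∃ f : P ≃ₗ[R] P', N.map f.toLinearMap = N' := by
  have h0' : N' ≠ ⊥ := by
    rintro rfl
    exact h0 (Submodule.subsingleton_iff_eq_bot.1 e.toEquiv.subsingleton)
  obtain ⟨m, hm⟩ := hP.exists_isGreatestProper
  obtain ⟨m', hm'⟩ := hP'.exists_isGreatestProper
  obtain ⟨q⟩ := hR.equiv_of_syzygy (FGModuleCat.of R (P ⧸ N)) (FGModuleCat.of R (P' ⧸ N')) 1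
    (hm.isIndec_quotient h1) (hm'.isIndec_quotient h1')
    (fun h => (eq_bot_or_eq_top_of_projective_quotient hP N h).elim h0 h1)
    (fun h => (eq_bot_or_eq_top_of_projective_quotient hP' N' h).elim h0' h1') (by
      rw [one_smul]
      exact ((syzygyHom_cls_quotient N).trans (cls_congr e)).trans
        (syzygyHom_cls_quotient N').symm)
  have q : (P ⧸ N) ≃ₗ[R] (P' ⧸ N') := q
  -- isomorphisms of quotients of local projective modules lift to surjections
  have lift : ∀ {A B : FGMod R} [Module.Projective R A] {K : Submodule R A} {L m : Submodule R B}
      (_ : IsGreatestProper m) (_ : L ≠ ⊤) (q : (A ⧸ K) ≃ₗ[R] (B ⧸ L)),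
      ∃ g : A →ₗ[R] B, L.mkQ ∘ₗ g = q.toLinearMap ∘ₗ K.mkQ ∧ Function.Surjective g := by
    intro A B _ K L m hm hL q
    obtain ⟨g, hg⟩ := Module.projective_lifting_property L.mkQ (q.toLinearMap ∘ₗ K.mkQ)
      L.mkQ_surjective
    refine ⟨g, hg, LinearMap.range_eq_top.1 (hm.eq_top_of_sup hL (top_le_iff.1 fun b _ => ?_))⟩
    obtain ⟨a, ha⟩ := K.mkQ_surjective (q.symm (L.mkQ b))
    have h2 : L.mkQ (g a) = L.mkQ b := by
      have := LinearMap.congr_fun hg a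
      simp only [LinearMap.comp_apply, LinearEquiv.coe_coe] at this
      rw [this, ha, LinearEquiv.apply_symm_apply]
    have h3 : b - g a ∈ L := by
      rw [← Submodule.Quotient.mk_eq_zero, ← Submodule.mkQ_apply, map_sub, h2, sub_self]
    rw [← add_sub_cancel (g a) b]
    exact add_mem (Submodule.mem_sup_left ⟨a, rfl⟩) (Submodule.mem_sup_right h3)
  obtain ⟨g, hg, hgs⟩ := lift hm' h1' q
  obtain ⟨g', -, hgs'⟩ := lift hm h1 q.symm
  have hgi : Function.Injective g := Function.Injective.of_comp (f := g')
    (IsNoetherian.bijective_of_surjective_endomorphism (g' ∘ₗ g) (hgs'.comp hgs)).1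
  refine ⟨LinearEquiv.ofBijective g ⟨hgi, hgs⟩, ?_⟩
  have hN : N = N'.comap g := by
    have h2 : LinearMap.ker (N'.mkQ ∘ₗ g) = LinearMap.ker (q.toLinearMap ∘ₗ N.mkQ) := by rw [hg]
    rw [LinearMap.ker_comp, LinearEquiv.ker_comp, N.ker_mkQ, N'.ker_mkQ] at h2
    exact h2.symm
  rw [hN]
  exact Submodule.map_comap_eq_of_surjective hgs N'

/-- A simple module embeds in at most one indecomposable projective module. -/
theorem nonempty_equiv_of_simple_equiv (hR : SyzygyRigid R) (hP : IsIndec R P) (hP' : IsIndec R P')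
    [Module.Projective R P] [Module.Projective R P'] {S : Submodule R P} {S' : Submodule R P'}
    [hS : IsSimpleModule R S] (e : S ≃ₗ[R] S') : Nonempty (P ≃ₗ[R] P') := by
  have hS' : IsSimpleModule R S' := .congr e.symm
  have h0 := (isSimpleModule_iff_isAtom.1 hS).1
  have h0' := (isSimpleModule_iff_isAtom.1 hS').1
  by_cases h1 : S = ⊤
  · have e1 : P ≃ₗ[R] S' := (LinearEquiv.ofTop S h1).symm.trans e
    have h1' := (hR.eq_bot_or_eq_top_of_projective hP' S' (.of_equiv e1)).resolve_left h0'
    exact ⟨e1.trans (LinearEquiv.ofTop S' h1')⟩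
  · by_cases h1' : S' = ⊤
    · have e1 : P' ≃ₗ[R] S := (LinearEquiv.ofTop S' h1').symm.trans e.symm
      exact (h1 ((hR.eq_bot_or_eq_top_of_projective hP S (.of_equiv e1)).resolve_left h0)).elim
    · obtain ⟨f, -⟩ := hR.exists_equiv_map_eq hP hP' h0 h1 h1' e
      exact ⟨f⟩

end SyzygyRigid

theorem exists_finite_indec_summands (M : FGMod R) :
    ∃ s : Set (FGMod R), s.Finite ∧ ∀ X : FGMod R, IsIndec R X → IsSummand R X M →
      ∃ Y ∈ s, Nonempty (X ≃ₗ[R] Y) := by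
  induction M using indec_induction with
  | equiv M N e h =>
    obtain ⟨s, hs, h⟩ := h
    exact ⟨s, hs, fun X hX hXN => h X hX (hXN.trans (.of_equiv e.symm))⟩
  | zero M h =>
    refine ⟨∅, Set.finite_empty, fun X hX ⟨i, r, hir⟩ => ?_⟩
    have := hX.nontrivial
    have : Subsingleton X := (Function.LeftInverse.injective (g := r) (f := i)
      fun x => LinearMap.congr_fun hir x).subsingleton
    exact (not_subsingleton X this).elim
  | indec M h =>
    refine ⟨{M}, Set.finite_singleton M, fun X hX hXM => ⟨M, rfl, ?_⟩⟩
    have := hX.nontrivial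
    obtain ⟨e⟩ := hXM.nonempty_equiv h
    exact ⟨e.symm⟩
  | prod M N hM hN =>
    obtain ⟨s, hs, hM⟩ := hM
    obtain ⟨t, ht, hN⟩ := hN
    refine ⟨s ∪ t, hs.union ht, fun X hX hXM => ?_⟩
    rcases hX.isSummand_or_isSummand hXM with h | h
    · obtain ⟨Y, hY, e⟩ := hM X hX h
      exact ⟨Y, Or.inl hY, e⟩
    · obtain ⟨Y, hY, e⟩ := hN X hX h
      exact ⟨Y, Or.inr hY, e⟩

theorem IsIndec.isSummand_of_isSummand_pi {X : FGMod R} (hX : IsIndec R X) (n : ℕ)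
    (h : IsSummand R X (Fin n → R)) : IsSummand R X R := by
  induction n with
  | zero =>
    obtain ⟨i, r, hir⟩ := h
    have := hX.nontrivial
    have : Subsingleton X := (Function.LeftInverse.injective (g := r) (f := i)
      fun x => LinearMap.congr_fun hir x).subsingleton
    exact (not_subsingleton X this).elim
  | succ n ih =>
    have e : (Fin (n + 1) → R) ≃ₗ[R] R × (Fin n → R) :=
      (Fin.consLinearEquiv R fun _ => R).symm
    exact (hX.isSummand_or_isSummand (h.trans (.of_equiv e))).elim id ih

variable (R) in
/-- There are finitely many indecomposable projective modules up to isomorphism. -/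
theorem exists_finite_indec_projectives :
    ∃ s : Set (FGMod R), s.Finite ∧ ∀ P : FGMod R, IsIndec R P → Module.Projective R P →
      ∃ Y ∈ s, Nonempty (P ≃ₗ[R] Y) := by
  obtain ⟨s, hs, h⟩ := exists_finite_indec_summands (FGModuleCat.of R R)
  refine ⟨s, hs, fun P hP hp => h P hP ?_⟩
  obtain ⟨n, f, hf⟩ := Module.Finite.exists_fin' R P
  obtain ⟨g, hg⟩ := Module.projective_lifting_property f LinearMap.id hf
  exact hP.isSummand_of_isSummand_pi n ⟨g, f, hg⟩

variable (R) in
/-- Isomorphism of indecomposable projective modules. -/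
def indecProjectiveSetoid : Setoid {P : FGMod R // IsIndec R P ∧ Module.Projective R P} where
  r P Q := Nonempty (P.1 ≃ₗ[R] Q.1)
  iseqv := ⟨fun P => ⟨.refl R P.1⟩, fun ⟨e⟩ => ⟨e.symm⟩, fun ⟨e⟩ ⟨f⟩ => ⟨e.trans f⟩⟩

theorem finite_indecProjective : Finite (Quotient (indecProjectiveSetoid R)) := by
  obtain ⟨s, hs, h⟩ := exists_finite_indec_projectives R
  have := hs.to_subtype
  choose F hF e using h
  refine Finite.of_injective
    (fun q : Quotient (indecProjectiveSetoid R) =>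
      (⟨F q.out.1 q.out.2.1 q.out.2.2, hF _ _ _⟩ : s)) fun p q hpq => ?_
  have hpq := congrArg Subtype.val hpq
  simp only at hpq
  obtain ⟨f⟩ := e p.out.1 p.out.2.1 p.out.2.2
  obtain ⟨g⟩ := e q.out.1 q.out.2.1 q.out.2.2
  rw [← Quotient.out_equiv_out]
  rw [hpq] at f
  exact ⟨f.trans g.symm⟩

theorem exists_simple_submodule {M : Type*} [AddCommGroup M] [Module R M] [Module.Finite R M]
    [Nontrivial M] : ∃ S : Submodule R M, IsSimpleModule R S := by
  obtain ⟨S, hS, -⟩ := (IsAtomic.eq_bot_or_exists_atom_le (⊤ : Submodule R M)).resolve_left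
    top_ne_bot
  exact ⟨S, isSimpleModule_iff_isAtom.2 hS⟩

/-- The socle of an indecomposable projective module is isotypic. The map sending an
indecomposable projective module `P` to the projective cover of a simple submodule of `P` is
injective on isomorphism classes, hence surjective, so that every simple module occurs in the socle
of exactly one `P`, and as the simple submodule chosen there. -/
theorem SyzygyRigid.simple_equiv (hR : SyzygyRigid R) {P : FGMod R} (hP : IsIndec R P)
    [hp : Module.Projective R P] (S S' : Submodule R P) [IsSimpleModule R S]
    [IsSimpleModule R S'] : Nonempty (S ≃ₗ[R] S') := by
  have hcover : ∀ {Q : FGMod R} (T : Submodule R Q) [IsSimpleModule R T],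
      ∃ (C : {P : FGMod R // IsIndec R P ∧ Module.Projective R P}) (f : C.1 →ₗ[R] T),
        IsProjectiveCover f := fun {Q} T _ => by
    obtain ⟨C, f, hf⟩ := exists_isProjectiveCover (FGModuleCat.of R T)
    have : IsSimpleModule R (FGModuleCat.of R T) := ‹IsSimpleModule R T›
    exact ⟨⟨C, hf.isGreatestProper_ker.isIndec, hf.projective⟩, f, hf⟩
  have hchoice : ∀ q : Quotient (indecProjectiveSetoid R),
      ∃ (T : Submodule R q.out.1) (_ : IsSimpleModule R T)
        (C : {P : FGMod R // IsIndec R P ∧ Module.Projective R P}) (f : C.1 →ₗ[R] T),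
        IsProjectiveCover f := fun q => by
    have := q.out.2.1.nontrivial
    obtain ⟨T, hT⟩ := exists_simple_submodule (R := R) (M := q.out.1)
    exact ⟨T, hT, hcover T⟩
  choose T hT C f hf using hchoice
  have hinj : Function.Injective fun q => (⟦C q⟧ : Quotient (indecProjectiveSetoid R)) := by
    intro p q hpq
    obtain ⟨e⟩ := Quotient.exact hpq
    obtain ⟨e'⟩ := (hf p).simple_equiv (hf q) e
    rw [← Quotient.out_equiv_out]
    have := p.out.2.2
    have := q.out.2.2
    exact hR.nonempty_equiv_of_simple_equiv p.out.2.1 q.out.2.1 e'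
  have := finite_indecProjective (R := R)
  have hsurj := Finite.surjective_of_injective hinj
  let p : Quotient (indecProjectiveSetoid R) := ⟦⟨P, hP, hp⟩⟧
  have key : ∀ (U : Submodule R P) [IsSimpleModule R U], Nonempty (U ≃ₗ[R] T p) := by
    intro U _
    obtain ⟨D, g, hg⟩ := hcover U
    obtain ⟨q, hq⟩ := hsurj ⟦D⟧
    obtain ⟨e⟩ := Quotient.exact hq
    obtain ⟨e'⟩ := hg.simple_equiv (hf q) e.symm
    have := q.out.2.2
    have hqp : p = q := by
      rw [← q.out_eq]
      exact Quotient.sound (hR.nonempty_equiv_of_simple_equiv hP q.out.2.1 e')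
    subst hqp
    exact ⟨e'⟩
  obtain ⟨e⟩ := key S
  obtain ⟨e'⟩ := key S'
  exact ⟨e.trans e'.symm⟩

theorem SyzygyRigid.exists_equiv_map_simple_eq (hR : SyzygyRigid R) {P : FGMod R}
    (hP : IsIndec R P) [hp : Module.Projective R P] (S S' : Submodule R P) [hS : IsSimpleModule R S]
    [hS' : IsSimpleModule R S'] : ∃ f : P ≃ₗ[R] P, S.map f.toLinearMap = S' := by
  obtain ⟨e⟩ := hR.simple_equiv hP S S'
  have h0 := (isSimpleModule_iff_isAtom.1 hS).1
  have h0' := (isSimpleModule_iff_isAtom.1 hS').1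
  by_cases h1 : S = ⊤
  · refine ⟨.refl R P, ?_⟩
    have h2 : S' = S := ((isSimpleModule_iff_isAtom.1 hS).le_iff.1 (h1 ▸ le_top)).resolve_left h0'
    rw [h2]
    exact Submodule.map_id S
  · refine hR.exists_equiv_map_eq hP hP h0 h1 (fun h1' => h1 ?_) e
    have h2 : S = S' := ((isSimpleModule_iff_isAtom.1 hS').le_iff.1 (h1' ▸ le_top)).resolve_left h0
    rw [h2, h1']

end Rigid

/-! ### Radicals of indecomposable projective modules -/

section Radical

variable {R : Type u} [Ring R] [IsArtinianRing R]

/-- Two indecomposable summands `Y`, `Y'` of the radical of an indecomposable projective module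
`P` are isomorphic: an automorphism of `P` moving a simple submodule of `Y` to one of `Y'`
induces maps `Y → Y' → Y` whose composite is the identity on that simple submodule. -/
theorem SyzygyRigid.equiv_of_isSummand_radical (hR : SyzygyRigid R) {P : FGMod R}
    (hP : IsIndec R P) [Module.Projective R P] {m : Submodule R P} (hm : IsGreatestProper m)
    {Y Y' : FGMod R} (hY : IsIndec R Y) (hY' : IsIndec R Y') (hs : IsSummand R Y m)
    (hs' : IsSummand R Y' m) : Nonempty (Y ≃ₗ[R] Y') := by
  obtain ⟨i, r, hir⟩ := hs
  obtain ⟨i', r', hir'⟩ := hs'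
  have hri : ∀ y, r (i y) = y := fun y => LinearMap.congr_fun hir y
  have hri' : ∀ y, r' (i' y) = y := fun y => LinearMap.congr_fun hir' y
  have := hY.nontrivial
  have := hY'.nontrivial
  obtain ⟨S, hS⟩ := exists_simple_submodule (R := R) (M := Y)
  obtain ⟨S', hS'⟩ := exists_simple_submodule (R := R) (M := Y')
  have hi : Function.Injective (m.subtype ∘ₗ i) :=
    m.subtype_injective.comp (Function.LeftInverse.injective hri)
  have hi' : Function.Injective (m.subtype ∘ₗ i') :=
    m.subtype_injective.comp (Function.LeftInverse.injective hri')
  have : IsSimpleModule R (S.map (m.subtype ∘ₗ i)) :=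
    .congr (Submodule.equivMapOfInjective _ hi S).symm
  have : IsSimpleModule R (S'.map (m.subtype ∘ₗ i')) :=
    .congr (Submodule.equivMapOfInjective _ hi' S').symm
  obtain ⟨f, hf⟩ := hR.exists_equiv_map_simple_eq hP (S.map (m.subtype ∘ₗ i))
    (S'.map (m.subtype ∘ₗ i'))
  let a : m →ₗ[R] m := f.toLinearMap.restrict fun x hx =>
    hm.map_equiv f (Submodule.mem_map_of_mem hx)
  let b : m →ₗ[R] m := f.symm.toLinearMap.restrict fun x hx =>
    hm.map_equiv f.symm (Submodule.mem_map_of_mem hx)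
  have := hS.nontrivial
  obtain ⟨⟨x, hx⟩, hx0⟩ := exists_ne (0 : S)
  have hx0 : x ≠ 0 := fun h => hx0 (Subtype.ext h)
  have h1 : f (i x) ∈ S'.map (m.subtype ∘ₗ i') := by
    rw [← hf]
    exact Submodule.mem_map_of_mem (Submodule.mem_map_of_mem hx)
  obtain ⟨y, -, hy⟩ := h1
  have hy1 : a (i x) = i' y := Subtype.ext hy.symm
  have hy2 : b (i' y) = i x := by
    rw [← hy1]
    exact Subtype.ext (f.symm_apply_apply _)
  have hfix : ((r ∘ₗ b ∘ₗ i') ∘ₗ (r' ∘ₗ a ∘ₗ i)) x = x := by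
    simp only [LinearMap.comp_apply]
    rw [hy1, hri', hy2, hri]
  obtain ⟨e⟩ := (IsSummand.of_bijective (hY.bijective_of_fixed _ hx0 hfix)).nonempty_equiv hY'
  exact ⟨e.symm⟩

theorem exists_cls_eq_nsmul (Y M : FGMod R)
    (h : ∀ Z : FGMod R, IsIndec R Z → IsSummand R Z M → Nonempty (Z ≃ₗ[R] Y)) :
    ∃ n : ℕ, cls R M = n • cls R Y := by
  induction M using indec_induction with
  | equiv M N e ih =>
    obtain ⟨n, hn⟩ := ih fun Z hZ hs => h Z hZ (hs.trans (.of_equiv e))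
    exact ⟨n, (cls_congr e).symm.trans hn⟩
  | zero M hM => exact ⟨0, by rw [zero_smul, cls_of_projective]⟩
  | indec M hM =>
    obtain ⟨e⟩ := h M hM .refl
    exact ⟨1, by rw [one_smul, cls_congr e]⟩
  | prod M N ih ih' =>
    obtain ⟨n, hn⟩ := ih fun Z hZ hs => h Z hZ (hs.trans .fst)
    obtain ⟨n', hn'⟩ := ih' fun Z hZ hs => h Z hZ (hs.trans .snd)
    exact ⟨n + n', by rw [add_smul, ← hn, ← hn', ← cls_prod]⟩

/-- The radical `m` of an indecomposable projective module `P` is zero or indecomposable: otherwise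
it is a sum of `n ≥ 2` copies of an indecomposable module `Y`, and the syzygy class of `P / m` is
`n` times that of `P / Y`. -/
theorem SyzygyRigid.eq_bot_or_isIndec_radical (hR : SyzygyRigid R) {P : FGMod R}
    (hP : IsIndec R P) [Module.Projective R P] {m : Submodule R P} (hm : IsGreatestProper m) :
    m = ⊥ ∨ IsIndec R m := by
  refine or_iff_not_imp_left.2 fun h0 => ?_
  have hmp : ¬ Module.Projective R m := fun h =>
    (hR.eq_bot_or_eq_top_of_projective hP m h).elim h0 hm.ne_top
  obtain ⟨Y, hY, hYp, hs⟩ :=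
    exists_indec_summand_of_not_projective (FGModuleCat.of R m) hmp
  obtain ⟨n, hn⟩ := exists_cls_eq_nsmul Y (FGModuleCat.of R m) fun Z hZ hZs =>
    hR.equiv_of_isSummand_radical hP hm hZ hY hZs hs
  obtain ⟨i, r, hir⟩ := hs
  have hi : Function.Injective (m.subtype ∘ₗ i) :=
    m.subtype_injective.comp (Function.LeftInverse.injective (g := r) fun y =>
      LinearMap.congr_fun hir y)
  let K : Submodule R P := LinearMap.range (m.subtype ∘ₗ i)
  let eK : Y ≃ₗ[R] K := LinearEquiv.ofInjective _ hi
  have hKm : K ≤ m := by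
    rintro _ ⟨y, rfl⟩
    exact (i y).2
  have hKt : K ≠ ⊤ := fun h => hm.ne_top (top_le_iff.1 (h ▸ hKm))
  have hK0 : K ≠ ⊥ := fun h => by
    have := hY.nontrivial
    have := eK.symm.toEquiv.nontrivial
    exact not_subsingleton K (Submodule.subsingleton_iff_eq_bot.2 h)
  obtain ⟨e⟩ := hR.equiv_of_syzygy (FGModuleCat.of R (P ⧸ m)) (FGModuleCat.of R (P ⧸ K)) n
    (hm.isIndec_quotient hm.ne_top) (hm.isIndec_quotient hKt)
    (fun h => (eq_bot_or_eq_top_of_projective_quotient hP m h).elim h0 hm.ne_top)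
    (fun h => (eq_bot_or_eq_top_of_projective_quotient hP K h).elim hK0 hKt) (by
      refine (syzygyHom_cls_quotient m).trans (Eq.trans hn ?_)
      exact congrArg (n • ·) ((cls_congr eK).trans (syzygyHom_cls_quotient K).symm))
  have e : (P ⧸ m) ≃ₗ[R] (P ⧸ K) := e
  have : IsSimpleModule R (P ⧸ m) := isSimpleModule_iff_isCoatom.2 hm.isCoatom
  have hKc : IsCoatom K := isSimpleModule_iff_isCoatom.1 (.congr e.symm)
  rw [← hm.eq_of_isCoatom hKc]
  exact hY.of_equiv eK

end Radical

/-! ### Nonsplit extensions of simple modules -/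

section Extension

/-- An extension `M` of a simple module by a submodule `K` is indecomposable if it does not split,
`K` is indecomposable, and `K` has a greatest proper submodule that is zero or indecomposable. -/
theorem isIndec_of_isCoatom {R M : Type*} [Ring R] [AddCommGroup M] [Module R M]
    {K m : Submodule R M} (hc : IsCoatom K) (hK : IsIndec R K) (hmK : m < K)
    (hm : ∀ N, N < K → N ≤ m) (hm' : m = ⊥ ∨ IsIndec R m) (hs : ∀ C, ¬ IsCompl K C) :
    IsIndec R M := by
  -- indecomposability of submodules, in terms of the lattice of submodules of `M`
  have hsub : ∀ {L p q : Submodule R M}, IsIndec R L → Disjoint p q → p ⊔ q = L →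
      p = ⊥ ∨ q = ⊥ := by
    intro L p q hL hd hpq
    have hp : p ≤ L := hpq ▸ le_sup_left
    have hq : q ≤ L := hpq ▸ le_sup_right
    have hcompl : IsCompl (p.submoduleOf L) (q.submoduleOf L) := by
      constructor
      · rw [disjoint_iff, Submodule.submoduleOf, Submodule.submoduleOf, ← Submodule.comap_inf,
          hd.eq_bot, Submodule.comap_bot, Submodule.ker_subtype]
      · rw [codisjoint_iff, ← Submodule.submoduleOf_sup_of_le hp hq, hpq,
          Submodule.submoduleOf_self]
    refine (hL.eq_bot_or_eq_bot _ _ hcompl).imp (fun h => ?_) fun h => ?_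
    · exact (Submodule.eq_bot_iff _).2 fun x hx =>
        congrArg Subtype.val ((Submodule.eq_bot_iff _).1 h ⟨x, hp hx⟩ hx)
    · exact (Submodule.eq_bot_iff _).2 fun x hx =>
        congrArg Subtype.val ((Submodule.eq_bot_iff _).1 h ⟨x, hq hx⟩ hx)
  refine ⟨?_, fun U V hUV => ?_⟩
  · exact (Submodule.nontrivial_iff R).1 ⟨K, ⊤, hc.1⟩
  -- a summand contained in `K` is zero, as otherwise the complementary summand complements `K`
  have hle : ∀ {U V : Submodule R M}, IsCompl U V → V ≤ K → V = ⊥ := by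
    intro U V hUV hV
    have h1 : V ⊔ U ⊓ K = K := by
      rw [← sup_inf_assoc_of_le U hV, hUV.symm.sup_eq_top, top_inf_eq]
    refine (hsub hK (hUV.symm.disjoint.mono_right inf_le_left) h1).resolve_right fun h2 => ?_
    exact hs U ⟨disjoint_iff.2 (inf_comm U K ▸ h2),
      codisjoint_iff.2 (top_le_iff.1 (hUV.symm.sup_eq_top ▸ sup_le_sup_right hV U))⟩
  by_contra hne
  rw [not_or] at hne
  have hU : U ⊔ K = ⊤ := hc.2 _ (lt_of_le_of_ne le_sup_right fun h => hne.1 (hle hUV.symm (by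
    rw [h]; exact le_sup_left)))
  have hV : V ⊔ K = ⊤ := hc.2 _ (lt_of_le_of_ne le_sup_right fun h => hne.2 (hle hUV (by
    rw [h]; exact le_sup_left)))
  -- the intersections of the two summands with `K` decompose its greatest proper submodule
  have hUK : U ⊓ K ≠ ⊥ := fun h => hs U ⟨disjoint_iff.2 (inf_comm U K ▸ h),
    codisjoint_iff.2 (sup_comm U K ▸ hU)⟩
  have hVK : V ⊓ K ≠ ⊥ := fun h => hs V ⟨disjoint_iff.2 (inf_comm V K ▸ h),
    codisjoint_iff.2 (sup_comm V K ▸ hV)⟩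
  have hd : Disjoint (U ⊓ K) (V ⊓ K) := hUV.disjoint.mono inf_le_left inf_le_left
  have h1 : U ⊓ K ⋖ U := CovBy.inf_of_sup_right (hU ▸ hc.covBy_top)
  have h2 : U ⊓ (U ⊓ K ⊔ V) = U ⊓ K := by
    rw [inf_comm, sup_inf_assoc_of_le V inf_le_left, hUV.symm.disjoint.eq_bot, sup_bot_eq]
  have h3 : U ⊔ (U ⊓ K ⊔ V) = ⊤ :=
    top_le_iff.1 (hUV.sup_eq_top ▸ sup_le_sup_left le_sup_right U)
  have h4 : U ⊓ K ⊔ V ⋖ ⊤ := h3 ▸ CovBy.sup_of_inf_left (h2.symm ▸ h1)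
  have h5 : (U ⊓ K ⊔ V) ⊔ K = ⊤ := top_le_iff.1 (hV ▸ sup_le_sup_right le_sup_right K)
  have h6 : (U ⊓ K ⊔ V) ⊓ K = U ⊓ K ⊔ V ⊓ K := sup_inf_assoc_of_le V inf_le_right
  have h7 : U ⊓ K ⊔ V ⊓ K ⋖ K := h6 ▸ CovBy.inf_of_sup_left (h5.symm ▸ h4)
  have h8 : U ⊓ K ⊔ V ⊓ K = m := by
    refine (hm _ h7.lt).eq_or_lt.resolve_right fun h => ?_
    exact h7.2 h hmK
  rcases hm' with h | h
  · rw [h, sup_eq_bot_iff] at h8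
    exact hUK h8.1
  · exact (hsub h hd h8).elim hUK hVK

end Extension

/-! ### Self-injectivity -/

section SelfInjective

/-- The dual of Schanuel's lemma, for embeddings along which homomorphisms extend. -/
theorem dual_schanuel {R : Type*} [Ring R] {X P Q U V : Type*} [AddCommGroup X] [Module R X] [AddCommGroup P]
    [Module R P] [AddCommGroup Q] [Module R Q] [AddCommGroup U] [Module R U] [AddCommGroup V]
    [Module R V] {i : X →ₗ[R] P} {j : X →ₗ[R] Q} {s : P →ₗ[R] Q} {t : Q →ₗ[R] P}
    (hs : s ∘ₗ i = j) (ht : t ∘ₗ j = i) {a : P →ₗ[R] U} {b : Q →ₗ[R] V}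
    (ha : Function.Surjective a) (hb : Function.Surjective b)
    (hai : LinearMap.ker a = LinearMap.range i) (hbj : LinearMap.ker b = LinearMap.range j) :
    Nonempty ((U × Q) ≃ₗ[R] (P × V)) := by
  have hs' : ∀ x, s (i x) = j x := fun x => LinearMap.congr_fun hs x
  have ht' : ∀ x, t (j x) = i x := fun x => LinearMap.congr_fun ht x
  let α : (P × Q) ≃ₗ[R] P × Q :=
    { toFun := fun z => (z.1 - t (z.2 + s z.1), z.2 + s z.1)
      invFun := fun w => (w.1 + t w.2, w.2 - s (w.1 + t w.2))
      map_add' := fun z w => by ext <;> simp <;> abel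
      map_smul' := fun c z => by ext <;> simp [smul_sub]
      left_inv := fun z => by ext <;> simp
      right_inv := fun w => by ext <;> simp }
  let A : (P × Q) →ₗ[R] U × Q := a.prodMap LinearMap.id
  let B : (P × Q) →ₗ[R] P × V := LinearMap.id.prodMap b ∘ₗ α.toLinearMap
  have hA : Function.Surjective A := ha.prodMap Function.surjective_id
  have hB : Function.Surjective B :=
    (Function.surjective_id.prodMap hb).comp α.surjective
  have hAB : LinearMap.ker A = LinearMap.ker B := by
    ext ⟨p, q⟩
    have h1 : (p, q) ∈ LinearMap.ker A ↔ p ∈ LinearMap.range i ∧ q = 0 := by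
      rw [← hai]
      exact Prod.mk_eq_zero
    have h2 : (p, q) ∈ LinearMap.ker B ↔
        p - t (q + s p) = 0 ∧ q + s p ∈ LinearMap.range j := by
      rw [← hbj]
      exact Prod.mk_eq_zero
    rw [h1, h2]
    constructor
    · rintro ⟨⟨x, rfl⟩, rfl⟩
      rw [zero_add, hs', ht', sub_self]
      exact ⟨rfl, x, rfl⟩
    · rintro ⟨h3, x, h4⟩
      rw [← h4, ht', sub_eq_zero] at h3
      refine ⟨⟨x, h3.symm⟩, ?_⟩
      rw [h3, hs'] at h4
      exact left_eq_add.1 (add_comm q (j x) ▸ h4)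
  exact ⟨(A.quotKerEquivOfSurjective hA).symm.trans
    ((Submodule.quotEquivOfEq _ _ hAB).trans (B.quotKerEquivOfSurjective hB))⟩

variable {R : Type u} [Ring R] [IsArtinianRing R]

/-- Homomorphisms from the radical of an indecomposable projective module `P` to another one `P'`
extend to `P`. Otherwise the pushout `M` of `P` along the homomorphism is a nonsplit extension of
the simple top of `P` by `P'`; it is indecomposable and has the same syzygy class as that top. -/
theorem SyzygyRigid.exists_extension_radical (hR : SyzygyRigid R) {P P' : FGMod R}
    (hP : IsIndec R P) (hP' : IsIndec R P') [Module.Projective R P] [Module.Projective R P']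
    {m : Submodule R P} (hm : IsGreatestProper m) (f : m →ₗ[R] P') :
    ∃ g : P →ₗ[R] P', ∀ x : m, g x = f x := by
  by_contra hext
  have hm0 : m ≠ ⊥ := by
    rintro rfl
    refine hext ⟨0, fun x => ?_⟩
    rw [Subsingleton.elim x 0, map_zero, LinearMap.zero_apply]
  have hj : Function.Injective (m.subtype.prod f) := fun x y h =>
    Subtype.ext (congrArg Prod.fst h)
  let D : Submodule R (P × P') := LinearMap.range (m.subtype.prod f)
  have hD : ∀ x : m, D.mkQ ((x : P), f x) = 0 := fun x =>
    (Submodule.Quotient.mk_eq_zero D).2 ⟨x, rfl⟩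
  let M : FGMod R := FGModuleCat.of R ((P × P') ⧸ D)
  let i : P' →ₗ[R] M := D.mkQ ∘ₗ LinearMap.inr R P P'
  have hi : Function.Injective i := by
    rw [← LinearMap.ker_eq_bot, LinearMap.ker_eq_bot']
    intro q hq
    obtain ⟨x, hx⟩ := (Submodule.Quotient.mk_eq_zero D).1 hq
    have h1 : (x : P) = 0 := congrArg Prod.fst hx
    have h2 : f x = q := congrArg Prod.snd hx
    rw [← h2, show x = 0 from Subtype.ext h1, map_zero]
  let π : M →ₗ[R] P ⧸ m := D.liftQ (m.mkQ ∘ₗ LinearMap.fst R P P') (by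
    rintro _ ⟨x, rfl⟩
    exact (Submodule.Quotient.mk_eq_zero m).2 x.2)
  have hπ : Function.Surjective π := fun y => by
    obtain ⟨p, rfl⟩ := m.mkQ_surjective y
    exact ⟨D.mkQ (p, 0), rfl⟩
  have hK : LinearMap.ker π = LinearMap.range i := by
    apply le_antisymm
    · intro z hz
      obtain ⟨⟨p, q⟩, rfl⟩ := D.mkQ_surjective z
      have hp : p ∈ m := (Submodule.Quotient.mk_eq_zero m).1 hz
      refine ⟨q - f ⟨p, hp⟩, ?_⟩
      have h1 : ((0 : P), q - f ⟨p, hp⟩) = (p, q) - (p, f ⟨p, hp⟩) := by simp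
      change D.mkQ (0, q - f ⟨p, hp⟩) = _
      rw [h1, map_sub, hD ⟨p, hp⟩, sub_zero]
    · rintro _ ⟨q, rfl⟩
      exact map_zero m.mkQ
  have hsimple : IsSimpleModule R (P ⧸ m) := isSimpleModule_iff_isCoatom.2 hm.isCoatom
  have hc : IsCoatom (LinearMap.range i) := hK ▸ LinearMap.isCoatom_ker_of_surjective hπ
  obtain ⟨m', hm'⟩ := hP'.exists_isGreatestProper
  have hM : IsIndec R M := by
    refine isIndec_of_isCoatom (m := m'.map i) hc (hP'.of_equiv (LinearEquiv.ofInjective i hi))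
      ?_ (fun N hN => ?_) ?_ fun C hC => hext ?_
    · rw [LinearMap.range_eq_map]
      refine lt_of_le_of_ne (Submodule.map_mono le_top) fun h => hm'.ne_top ?_
      exact Submodule.map_injective_of_injective hi h
    · have h1 : (N.comap i).map i = N := by
        rw [Submodule.map_comap_eq, inf_eq_right]
        exact hN.le
      rw [← h1]
      refine Submodule.map_mono (hm'.le _ fun h2 => hN.ne ?_)
      rw [← h1, h2, LinearMap.range_eq_map]
    · refine (hR.eq_bot_or_isIndec_radical hP' hm').imp (fun h => ?_) fun h => ?_
      · rw [h, Submodule.map_bot]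
      · exact h.of_equiv (Submodule.equivMapOfInjective i hi m')
    -- a complement of `P'` in the pushout gives an extension of `f`
    · let ρ : M →ₗ[R] P' :=
        (LinearEquiv.ofInjective i hi).symm.toLinearMap ∘ₗ Submodule.projectionOnto _ C hC
      have hρ : ∀ q, ρ (i q) = q := fun q => by
        have h1 : Submodule.projectionOnto _ C hC (i q) = LinearEquiv.ofInjective i hi q :=
          Submodule.projectionOnto_apply_left hC (LinearEquiv.ofInjective i hi q)
        simp only [ρ, LinearMap.comp_apply, LinearEquiv.coe_coe]
        rw [h1, LinearEquiv.symm_apply_apply]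
      refine ⟨-(ρ ∘ₗ D.mkQ ∘ₗ LinearMap.inl R P P'), fun x => ?_⟩
      have h1 : D.mkQ ((x : P), 0) = - i (f x) := by
        have h2 : ((x : P), (0 : P')) = ((x : P), f x) - (0, f x) := by simp
        rw [h2, map_sub, hD, zero_sub]
        rfl
      change - ρ (D.mkQ ((x : P), 0)) = f x
      rw [h1, map_neg, neg_neg, hρ]
  have hpm : ¬ Module.Projective R (P ⧸ m) := fun h =>
    (eq_bot_or_eq_top_of_projective_quotient hP m h).elim hm0 hm.ne_top
  have hT : syzygyHom R (cls R (P ⧸ m)) = syzygyHom R (cls R M) := by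
    refine (syzygyHom_cls_quotient m).trans (Eq.trans ?_ (syzygyHom_cls_quotient D).symm)
    exact cls_congr (LinearEquiv.ofInjective _ hj)
  have hMp : ¬ Module.Projective R M := fun h => hpm
    (hR.projective_of_syzygy (FGModuleCat.of R (P ⧸ m)) (by
      change syzygyHom R (cls R (P ⧸ m)) = 0
      rw [hT, cls_of_projective, map_zero]))
  obtain ⟨e⟩ := hR.equiv_of_syzygy (FGModuleCat.of R (P ⧸ m)) M 1
    (hm.isIndec_quotient hm.ne_top) hM hpm hMp (by rw [one_smul]; exact hT)
  have e : (P ⧸ m) ≃ₗ[R] M := e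
  have : IsSimpleModule R M := .congr e.symm
  have := hP'.nontrivial
  rcases eq_bot_or_eq_top (LinearMap.range i) with h | h
  · obtain ⟨q, hq⟩ := exists_ne (0 : P')
    refine hq (hi ?_)
    rw [LinearMap.range_eq_bot.1 h]
    rfl
  · exact hc.1 h

/-- If homomorphisms to `Q` extend from the radical of an indecomposable projective module to the
whole module, then they extend from every submodule of a finitely generated module. -/
theorem exists_extension_of_radical {Q : FGMod R}
    (hQ : ∀ (P : FGMod R) (m : Submodule R P), IsIndec R P → Module.Projective R P →
      IsGreatestProper m → ∀ f : m →ₗ[R] Q, ∃ g : P →ₗ[R] Q, ∀ x : m, g x = f x)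
    (M : FGMod R) (X : Submodule R M) (f : X →ₗ[R] Q) :
    ∃ g : M →ₗ[R] Q, ∀ x : X, g x = f x := by
  -- enlarge `X` by the image of the projective cover of a simple submodule of `M / X`
  induction X using WellFoundedGT.induction with
  | ind X ih =>
  by_cases hX : X = ⊤
  · subst hX
    exact ⟨f ∘ₗ LinearMap.id.codRestrict ⊤ fun _ => Submodule.mem_top, fun x => rfl⟩
  have : Nontrivial (M ⧸ X) := Submodule.Quotient.nontrivial_iff.2 hX
  obtain ⟨S, hS⟩ := exists_simple_submodule (R := R) (M := M ⧸ X)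
  have : IsSimpleModule R (FGModuleCat.of R S) := hS
  obtain ⟨P, p, hp⟩ := exists_isProjectiveCover (FGModuleCat.of R S)
  have := hp.projective
  have hker := hp.isGreatestProper_ker
  obtain ⟨c, hc⟩ := Module.projective_lifting_property X.mkQ (S.subtype ∘ₗ p) X.mkQ_surjective
  have hc' : ∀ y, X.mkQ (c y) = S.subtype (p y) := fun y => LinearMap.congr_fun hc y
  have hcX : ∀ y, c y ∈ X ↔ y ∈ LinearMap.ker p := fun y => by
    rw [← Submodule.Quotient.mk_eq_zero, ← Submodule.mkQ_apply, hc', LinearMap.mem_ker]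
    exact Submodule.coe_eq_zero
  obtain ⟨g₀, hg₀⟩ := hQ P _ hker.isIndec hp.projective hker
    (f ∘ₗ c.restrict fun y hy => (hcX y).2 hy)
  -- `f` and the extension of `f ∘ c` glue to a homomorphism on `X + c(P)`
  let a : X × P →ₗ[R] M := X.subtype.coprod c
  let b : X × P →ₗ[R] Q := f.coprod g₀
  have hab : LinearMap.ker a ≤ LinearMap.ker b := by
    rintro ⟨x, y⟩ hxy
    have h1 : (x : M) + c y = 0 := hxy
    have h2 : c y = -x := (neg_eq_of_add_eq_zero_right h1).symm
    have h3 : y ∈ LinearMap.ker p := (hcX y).1 (h2 ▸ neg_mem x.2)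
    have h4 := hg₀ ⟨y, h3⟩
    have h5 : (c.restrict fun y hy => (hcX y).2 hy : LinearMap.ker p →ₗ[R] X) ⟨y, h3⟩ = -x :=
      Subtype.ext h2
    rw [LinearMap.comp_apply, h5, map_neg] at h4
    change f x + g₀ y = 0
    exact h4 ▸ add_neg_cancel (f x)
  let f' : LinearMap.range a →ₗ[R] Q :=
    (LinearMap.ker a).liftQ b hab ∘ₗ a.quotKerEquivRange.symm.toLinearMap
  have hf' : ∀ z, f' ⟨a z, z, rfl⟩ = b z := fun z => by
    have h1 : a.quotKerEquivRange.symm ⟨a z, z, rfl⟩ = (LinearMap.ker a).mkQ z :=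
      a.quotKerEquivRange_symm_apply_image z ⟨z, rfl⟩
    simp only [f', LinearMap.comp_apply, LinearEquiv.coe_coe]
    rw [h1]
    rfl
  have hlt : X < LinearMap.range a := by
    refine lt_of_le_of_ne (fun x hx => ⟨(⟨x, hx⟩, 0), by simp [a]⟩) fun h => hker.ne_top ?_
    rw [eq_top_iff]
    intro y _
    rw [← hcX, h]
    exact ⟨(0, y), by simp [a]⟩
  obtain ⟨g, hg⟩ := ih _ hlt f'
  refine ⟨g, fun x => ?_⟩
  have h1 := hg ⟨a (x, 0), _, rfl⟩
  rw [hf'] at h1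
  simpa [a, b] using h1

/-- In the rigid situation finitely generated projective modules are relatively injective. -/
theorem SyzygyRigid.exists_extension (hR : SyzygyRigid R) (Q : FGMod R)
    (hQ : Module.Projective R Q) (M : FGMod R) (X : Submodule R M) (f : X →ₗ[R] Q) :
    ∃ g : M →ₗ[R] Q, ∀ x : X, g x = f x := by
  induction Q using indec_induction with
  | equiv Q Q' e ih =>
    obtain ⟨g, hg⟩ := ih (.of_equiv e.symm) (e.symm.toLinearMap ∘ₗ f)
    refine ⟨e.toLinearMap ∘ₗ g, fun x => ?_⟩
    rw [LinearMap.comp_apply, hg]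
    exact e.apply_symm_apply _
  | zero Q h => exact ⟨0, fun x => Subsingleton.elim _ _⟩
  | indec Q h =>
    exact exists_extension_of_radical (fun P m hP hPp hm f =>
      hR.exists_extension_radical hP h hm f) M X f
  | prod Q Q' ih ih' =>
    have hQ : Module.Projective R (Q × Q') := hQ
    obtain ⟨g, hg⟩ := ih (IsSummand.fst (R := R) (X := Q) (Y := Q')).projective
      (LinearMap.fst R Q Q' ∘ₗ f)
    obtain ⟨g', hg'⟩ := ih' (IsSummand.snd (R := R) (X := Q) (Y := Q')).projective
      (LinearMap.snd R Q Q' ∘ₗ f)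
    exact ⟨g.prod g', fun x => Prod.ext (hg x) (hg' x)⟩

/-- In the rigid situation modules with the same syzygy class have the same class: their syzygies
are stably isomorphic, and the dual of Schanuel's lemma applies. -/
theorem SyzygyRigid.syzygyHom_injective (hR : SyzygyRigid R) (x : K0 R)
    (hx : syzygyHom R x = 0) : x = 0 := by
  obtain ⟨U, V, rfl⟩ := exists_eq_cls_sub_cls x
  obtain ⟨P, a, ha⟩ := exists_isProjectiveCover U
  obtain ⟨Q, b, hb⟩ := exists_isProjectiveCover V
  have hP := ha.projective
  have hQ := hb.projective
  rw [map_sub, syzygyHom_cls a ha.surjective, syzygyHom_cls b hb.surjective, sub_eq_zero] at hx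
  obtain ⟨P', Q', hP', hQ', ⟨e⟩⟩ := stably_iso_of_cls_eq hx
  let i : (LinearMap.ker a × P') →ₗ[R] P × P' :=
    (LinearMap.ker a).subtype.prodMap LinearMap.id
  let j' : (LinearMap.ker b × Q') →ₗ[R] Q × Q' :=
    (LinearMap.ker b).subtype.prodMap LinearMap.id
  let j : (LinearMap.ker a × P') →ₗ[R] Q × Q' := j' ∘ₗ e.toLinearMap
  have hi : Function.Injective i :=
    (LinearMap.ker a).subtype_injective.prodMap Function.injective_id
  have hj : Function.Injective j :=
    ((LinearMap.ker b).subtype_injective.prodMap Function.injective_id).comp e.injective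
  have hPP : Module.Projective R (P × P') := inferInstance
  have hQQ : Module.Projective R (Q × Q') := inferInstance
  obtain ⟨s, hs⟩ := hR.exists_extension (directSum Q Q') hQQ (directSum P P')
    (LinearMap.range i) (j ∘ₗ (LinearEquiv.ofInjective i hi).symm.toLinearMap)
  obtain ⟨t, ht⟩ := hR.exists_extension (directSum P P') hPP (directSum Q Q')
    (LinearMap.range j) (i ∘ₗ (LinearEquiv.ofInjective j hj).symm.toLinearMap)
  have hs' : s ∘ₗ i = j := by
    refine LinearMap.ext fun y => ?_
    have h1 := hs (LinearEquiv.ofInjective i hi y)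
    rwa [LinearMap.comp_apply, LinearEquiv.coe_coe, LinearEquiv.symm_apply_apply] at h1
  have ht' : t ∘ₗ j = i := by
    refine LinearMap.ext fun y => ?_
    have h1 := ht (LinearEquiv.ofInjective j hj y)
    rwa [LinearMap.comp_apply, LinearEquiv.coe_coe, LinearEquiv.symm_apply_apply] at h1
  have hker : ∀ {A B C : Type u} [AddCommGroup A] [Module R A] [AddCommGroup B] [Module R B]
      [AddCommGroup C] [Module R C] (c : A →ₗ[R] B),
      LinearMap.ker (c ∘ₗ LinearMap.fst R A C) =
        LinearMap.range ((LinearMap.ker c).subtype.prodMap (LinearMap.id : C →ₗ[R] C)) := by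
    intro A B C _ _ _ _ _ _ c
    rw [LinearMap.range_prodMap, Submodule.range_subtype, LinearMap.range_id]
    ext ⟨y, z⟩
    simp
  obtain ⟨f⟩ := dual_schanuel hs' ht' (a := a ∘ₗ LinearMap.fst R P P')
    (b := b ∘ₗ LinearMap.fst R Q Q') (ha.surjective.comp Prod.fst_surjective)
    (hb.surjective.comp Prod.fst_surjective) (hker a)
    ((hker b).trans (LinearEquiv.range_comp e j').symm)
  have h1 : cls R U + cls R (Q × Q') = cls R (P × P') + cls R V :=
    cls_prod.symm.trans ((cls_congr f).trans cls_prod)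
  rw [cls_of_projective (M := Q × Q'), cls_of_projective (M := P × P'),
    add_zero, zero_add] at h1
  rw [h1, sub_self]

/-- If the `φ`-dimension is positive, there are indecomposable modules whose direct sum has
`φ`-value `1`. -/
theorem exists_phi_directSum_eq_one (h : 0 < phiDim R) :
    ∃ M₁ M₂ : FGMod R, IsIndec R M₁ ∧ IsIndec R M₂ ∧ phi (directSum M₁ M₂) = 1 := by
  obtain ⟨x, hx0, hx⟩ := exists_syzygyHom_eq_zero h
  exact syzygyRigid_or_exists_phi_eq_one.resolve_left fun hR =>
    hx0 (hR.syzygyHom_injective x hx)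

end SelfInjective

end IgusaTodorov

theorem theorem4p3 (k : Type*) (A : Type*) [Field k] [Ring A] [Algebra k A]
    [FiniteDimensional k A] :
    haveI : IsArtinianRing Aᵐᵒᵖ := IgusaTodorov.isArtinianRing_op k A
    (0 < IgusaTodorov.phiDim Aᵐᵒᵖ →
      ∃ M : IgusaTodorov.FGMod Aᵐᵒᵖ, IgusaTodorov.phi M = 1) ∧
    (∀ m : ℕ, 0 < m → IgusaTodorov.phiDim Aᵐᵒᵖ = m →
      ∃ N : IgusaTodorov.FGMod Aᵐᵒᵖ, IgusaTodorov.phi N = m - 1) ∧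
    (IgusaTodorov.gldim Aᵐᵒᵖ = ⊤ → 0 < IgusaTodorov.phiDim Aᵐᵒᵖ →
      ∃ M₁ M₂ : IgusaTodorov.FGMod Aᵐᵒᵖ,
        CategoryTheory.Indecomposable M₁.obj ∧ CategoryTheory.Indecomposable M₂.obj ∧
        IgusaTodorov.phi (IgusaTodorov.directSum M₁ M₂) = 1) := by
  have : IsArtinianRing Aᵐᵒᵖ := IgusaTodorov.isArtinianRing_op k A
  refine ⟨fun h => ?_, fun m hm h => IgusaTodorov.exists_phi_eq_sub_one hm h, fun _ h => ?_⟩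
  · obtain ⟨M₁, M₂, -, -, h₁₂⟩ := IgusaTodorov.exists_phi_directSum_eq_one h
    exact ⟨_, h₁₂⟩
  · obtain ⟨M₁, M₂, h₁, h₂, h₁₂⟩ := IgusaTodorov.exists_phi_directSum_eq_one h
    exact ⟨M₁, M₂, (IgusaTodorov.indecomposable_iff M₁).2 h₁,
      (IgusaTodorov.indecomposable_iff M₂).2 h₂, h₁₂⟩
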